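/- Let $d\ge 1$, let $m_d$ be the normalized Haar measure on the torus $\mathbb{T}^d$, and for $f\in L^1(\mathbb{T}^d)$ let $\widehat f(\alpha)=\int_{\mathbb{T}^d} f(z)\overline{z^\alpha}\,dm_d(z)$, $\alpha\in\mathbb{Z}^d$. For $1\le p\le\infty$ let $H^p(\mathbb{T}^d)$ be the subspace of those $f\in L^p(\mathbb{T}^d)$ with $\widehat f(\alpha)=0$ for every $\alpha\in\mathbb{Z}^d\setminus\mathbb{N}_0^d$, where $\mathbb{N}_0=\{0,1,2,\dots\}$, equipped with the norm of $L^p(\mathbb{T}^d)$, and write $\langle f,g\rangle=\int_{\mathbb{T}^d} f\,\overline{g}\,dm_d$. For $f,\varphi\in H^p(\mathbb{T}^d)$, the relation $\langle f,\varphi\rangle=0$ has its usual meaning if $p\ge2$; if $1\le p<2$ it means that $f$ lies in the closure in $H^p(\mathbb{T}^d)$ of the set of analytic polynomials $g$ (finite linear combinations of the monomials $z^\alpha$, $\alpha\in\mathbb{N}_0^d$) with $\langle g,\varphi\rangle=0$. A nontrivial (i.e. nonzero) $\varphi\in H^p(\mathbb{T}^d)$ is a *Hilbert point* in $H^p(\mathbb{T}^d)$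 if $\|\varphi\|_{H^p}\le\|\varphi+f\|_{H^p}$ for every $f\in H^p(\mathbb{T}^d)$ with $\langle f,\varphi\rangle=0$. The Riesz projection $P$ maps $\sum_{\alpha\in\mathbb{Z}^d}\widehat f(\alpha)z^\alpha$ to $\sum_{\alpha\in\mathbb{N}_0^d}\widehat f(\alpha)z^\alpha$: for $f,g\in L^1(\mathbb{T}^d)$, $Pf=g$ means that $\widehat g(\alpha)=\widehat f(\alpha)$ for $\alpha\in\mathbb{N}_0^d$ and $\widehat g(\alpha)=0$ for all other $\alpha\in\mathbb{Z}^d$. (On $L^2$ this is the orthogonal projection onto $H^2$.) For $\varphi\in H^p(\mathbb{T}^d)\cap H^2(\mathbb{T}^d)$, let $\|\varphi\|_{(H^p)^*}$ be the norm of the bounded linear functional $L_\varphi$ on $H^p(\mathbb{T}^d)$ that satisfies $L_\varphi(g)=\langle g,\varphi\rangle$ for all $g\in H^p(\mathbb{T}^d)\cap H^2(\mathbb{T}^d)$, that is, $\|\varphi\|_{(H^p)^*}=\sup_{0\ne g\in H^p}|L_\varphi(g)|/\|g\|_{H^p}$; if no such bounded functional exists, put $\|\varphi\|_{(H^p)^*}=\infty$.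 **Theorem.** (a) Let $1\le p<\infty$. A nontrivial function $\varphi$ in $H^p(\mathbb{T}^d)$ is a Hilbert point in $H^p(\mathbb{T}^d)$ if and only if there is a constant $\lambda>0$ such that $$P\left(|\varphi|^{p-2}\varphi\right)=\lambda\varphi,$$ where $|\varphi|^{p-2}\varphi$ is read as $0$ where $\varphi=0$. (b) Let $1\le p\le\infty$. A nontrivial function $\varphi$ in $H^p(\mathbb{T}^d)\cap H^2(\mathbb{T}^d)$ is a Hilbert point in $H^p(\mathbb{T}^d)$ if and only if $$\|\varphi\|_{H^p(\mathbb{T}^d)}\,\|\varphi\|_{(H^p(\mathbb{T}^d))^*}=\|\varphi\|_{H^2(\mathbb{T}^d)}^2.$$ -/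

import Mathlib

open MeasureTheory UnitAddTorus
open scoped ENNReal ComplexConjugate

noncomputable section

namespace HardyTorus

/-- The normalized Haar measure `m_d` of the `d`-dimensional torus. A point of the torus is given by
its angles `x`, with `z_j = exp (2 π i x_j)`; the monomial `z ^ α` is `mFourier α`. -/
abbrev haar (d : ℕ) : Measure (UnitAddTorus (Fin d)) :=
  Measure.pi fun _ => AddCircle.haarAddCircle

/-- `f` represents an element of the Hardy space `H^p`: it is in `L^p`, and its Fourier coefficients
vanish off the multi-indices with nonnegative entries. -/
def MemHardy (d : ℕ) (p : ℝ≥0∞) (f : UnitAddTorus (Fin d) → ℂ) : Prop :=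
  MemLp f p (haar d) ∧ ∀ α : Fin d → ℤ, ¬ 0 ≤ α → mFourierCoeff f α = 0

theorem mFourierCoeff_congr {d : ℕ} {f g : UnitAddTorus (Fin d) → ℂ} (h : f =ᵐ[haar d] g)
    (α : Fin d → ℤ) : mFourierCoeff f α = mFourierCoeff g α := by
  refine integral_congr_ae (μ := haar d) ?_
  filter_upwards [h] with x hx
  rw [hx]

theorem integrable_mFourier_smul {d : ℕ} {f : UnitAddTorus (Fin d) → ℂ}
    (hf : Integrable f (haar d)) (α : Fin d → ℤ) :
    Integrable (fun x => mFourier α x • f x) (haar d) := by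
  refine hf.bdd_smul 1 (mFourier α).continuous.aestronglyMeasurable (.of_forall fun x => ?_)
  exact ((mFourier α).norm_coe_le_norm x).trans mFourier_norm.le

theorem mFourierCoeff_add {d : ℕ} {f g : UnitAddTorus (Fin d) → ℂ} (hf : Integrable f (haar d))
    (hg : Integrable g (haar d)) (α : Fin d → ℤ) :
    mFourierCoeff (f + g) α = mFourierCoeff f α + mFourierCoeff g α := by
  refine Eq.trans ?_ (integral_add (integrable_mFourier_smul hf (-α))
    (integrable_mFourier_smul hg (-α)))
  simp only [mFourierCoeff, Pi.add_apply, smul_add]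

theorem mFourierCoeff_const_smul {d : ℕ} (c : ℂ) (f : UnitAddTorus (Fin d) → ℂ) (α : Fin d → ℤ) :
    mFourierCoeff (c • f) α = c * mFourierCoeff f α := by
  simp only [mFourierCoeff, Pi.smul_apply, smul_eq_mul, mul_left_comm _ c]
  exact integral_const_mul _ _

/-- The Hardy space `H^p` of the torus, as a subspace of `L^p`; it carries the norm of `L^p`. -/
def hardySpace (d : ℕ) (p : ℝ≥0∞) [hp : Fact (1 ≤ p)] : Submodule ℂ (Lp ℂ p (haar d)) where
  carrier := {f | MemHardy d p f}
  zero_mem' := by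
    refine ⟨Lp.memLp _, fun α _ => ?_⟩
    rw [mFourierCoeff_congr (Lp.coeFn_zero ℂ p (haar d))]
    simp [mFourierCoeff]
  add_mem' := by
    intro f g hf hg
    refine ⟨Lp.memLp _, fun α hα => ?_⟩
    rw [mFourierCoeff_congr (Lp.coeFn_add f g), mFourierCoeff_add ((Lp.memLp f).integrable hp.out)
      ((Lp.memLp g).integrable hp.out), hf.2 α hα, hg.2 α hα, add_zero]
  smul_mem' := by
    intro c f hf
    refine ⟨Lp.memLp _, fun α hα => ?_⟩
    rw [mFourierCoeff_congr (Lp.coeFn_smul c f), mFourierCoeff_const_smul, hf.2 α hα, mul_zero]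

/-- The analytic polynomials: finite linear combinations of the monomials `z ^ α` with
`α` in `ℕ ^ d`. -/
def analyticPolynomials (d : ℕ) (p : ℝ≥0∞) [Fact (1 ≤ p)] : Submodule ℂ (Lp ℂ p (haar d)) :=
  Submodule.span ℂ (Set.range fun α : Fin d → ℕ =>
    ContinuousMap.toLp (E := ℂ) p (haar d) ℂ (mFourier fun i => (α i : ℤ)))

/-- The usual inner product `⟨f, g⟩ = ∫ f \bar g dm_d`, conjugate-linear in the second entry. It is
only used where `f * conj g` is integrable. -/
def pairing {d : ℕ} (f g : UnitAddTorus (Fin d) → ℂ) : ℂ :=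
  ∫ x, f x * conj (g x) ∂haar d

/-- The relation `⟨f, φ⟩ = 0` for `f` and `φ` in `H^p`. When `p < 2` the product `f * conj φ` need
not be integrable, and the relation means that `f` is in the closure in `H^p` of the analytic
polynomials `g` with `⟨g, φ⟩ = 0`. -/
def IsOrthogonal {d : ℕ} {p : ℝ≥0∞} [Fact (1 ≤ p)] (f φ : Lp ℂ p (haar d)) : Prop :=
  (2 ≤ p ∧ pairing f φ = 0) ∨
    (p < 2 ∧ f ∈ closure {g : Lp ℂ p (haar d) | g ∈ analyticPolynomials d p ∧ pairing g φ = 0})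

/-- `φ` is a Hilbert point in `H^p`. -/
def IsHilbertPoint {d : ℕ} {p : ℝ≥0∞} [Fact (1 ≤ p)] (φ : Lp ℂ p (haar d)) : Prop :=
  φ ∈ hardySpace d p ∧ φ ≠ 0 ∧ ∀ f ∈ hardySpace d p, IsOrthogonal f φ → ‖φ‖ ≤ ‖φ + f‖

/-- The relation `P f = g`, where `P` is the Riesz projection
`∑_{α ∈ ℤ^d} \hat f(α) z^α ↦ ∑_{α ∈ ℕ^d} \hat f(α) z^α`, for integrable functions `f` and `g`.
As an integrable function is determined by its Fourier coefficients, there is at most one such `g`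
up to null sets; on `L^2` this is the orthogonal projection onto `H^2`. -/
def IsRieszProjection {d : ℕ} (f g : UnitAddTorus (Fin d) → ℂ) : Prop :=
  Integrable f (haar d) ∧ Integrable g (haar d) ∧
    ∀ α : Fin d → ℤ, (0 ≤ α → mFourierCoeff g α = mFourierCoeff f α) ∧
      (¬ 0 ≤ α → mFourierCoeff g α = 0)

theorem mFourierCoeff_monomial {d : ℕ} (p : ℝ≥0∞) [Fact (1 ≤ p)] (n α : Fin d → ℤ) :
    mFourierCoeff (ContinuousMap.toLp (E := ℂ) p (haar d) ℂ (mFourier n)) α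
      = if n = α then 1 else 0 := by
  rw [mFourierCoeff_congr (ContinuousMap.coeFn_toLp (haar d) (mFourier n)),
    ← mFourierCoeff_congr (ContinuousMap.coeFn_toLp (p := 2) (𝕜 := ℂ) (haar d) (mFourier n))]
  have h := mFourierBasis_repr (d := Fin d) (mFourierLp 2 n) α
  rw [← coe_mFourierBasis, HilbertBasis.repr_self] at h
  rw [coe_mFourierBasis] at h
  refine h.symm.trans ?_
  simp [lp.single_apply, Pi.single_apply, eq_comm]

/-- Analytic polynomials are in `H^p`. -/
theorem analyticPolynomials_le {d : ℕ} (p : ℝ≥0∞) [Fact (1 ≤ p)] :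
    analyticPolynomials d p ≤ hardySpace d p := by
  refine Submodule.span_le.2 ?_
  rintro _ ⟨α, rfl⟩
  refine ⟨Lp.memLp _, fun β hβ => ?_⟩
  rw [mFourierCoeff_monomial, if_neg]
  rintro rfl
  exact hβ fun i => by simp

theorem mFourierCoeff_eq_inner {d : ℕ} (f : Lp ℂ 2 (haar d)) (α : Fin d → ℤ) :
    mFourierCoeff f α = inner ℂ (ContinuousMap.toLp (E := ℂ) 2 (haar d) ℂ (mFourier α)) f := by
  rw [← mFourierBasis_repr]
  erw [HilbertBasis.repr_apply_apply, coe_mFourierBasis]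
  rfl

/-- On `L^2`, the relation `IsRieszProjection` is the orthogonal projection onto `H^2`. -/
theorem isRieszProjection_iff_orthogonal {d : ℕ} (f g : Lp ℂ 2 (haar d)) :
    IsRieszProjection f g ↔ g ∈ hardySpace d 2 ∧ ∀ h ∈ hardySpace d 2, inner ℂ h (f - g) = 0 := by
  have hi : ∀ u : Lp ℂ 2 (haar d), Integrable u (haar d) := fun u =>
    (Lp.memLp u).integrable one_le_two
  constructor
  · rintro ⟨-, -, h⟩
    refine ⟨⟨Lp.memLp _, fun α => (h α).2⟩, fun u hu => ?_⟩
    have := mFourierBasis.hasSum_inner_mul_inner u (f - g)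
    refine this.unique ?_
    convert hasSum_zero with α
    by_cases hα : 0 ≤ α
    · have h1 : inner ℂ (mFourierBasis α) (f - g) = 0 := by
        rw [coe_mFourierBasis, inner_sub_right]
        erw [← mFourierCoeff_eq_inner, ← mFourierCoeff_eq_inner, (h α).1 hα, sub_self]
      rw [h1, mul_zero]
    · have h1 : inner ℂ u (mFourierBasis α) = 0 := by
        rw [← inner_conj_symm, coe_mFourierBasis]
        erw [← mFourierCoeff_eq_inner, hu.2 α hα, map_zero]
      rw [h1, zero_mul]
  · rintro ⟨hg, h⟩
    refine ⟨hi f, hi g, fun α => ⟨fun hα => ?_, hg.2 α⟩⟩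
    have : ContinuousMap.toLp (E := ℂ) 2 (haar d) ℂ (mFourier α) ∈ hardySpace d 2 := by
      refine ⟨Lp.memLp _, fun β hβ => ?_⟩
      rw [mFourierCoeff_monomial, if_neg]
      rintro rfl
      exact hβ hα
    have := h _ this
    rw [inner_sub_right, ← mFourierCoeff_eq_inner, ← mFourierCoeff_eq_inner, sub_eq_zero] at this
    exact this.symm

/-- `L` is the bounded functional `L_φ : g ↦ ⟨g, φ⟩` on `H^p` generated by `φ ∈ H^2`: it is given by
the integral on `H^p ∩ H^2`, which is all of `H^p` when `p ≥ 2` and dense in `H^p` when `p < 2`. -/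
def IsFunctionalOf {d : ℕ} {p : ℝ≥0∞} [Fact (1 ≤ p)] (φ : UnitAddTorus (Fin d) → ℂ)
    (L : hardySpace d p →L[ℂ] ℂ) : Prop :=
  ∀ g : hardySpace d p, MemHardy d 2 (g : Lp ℂ p (haar d)) → L g = pairing (g : Lp ℂ p (haar d)) φ

/-- The norm of `φ ∈ H^2` in the dual space of `H^p`: the operator norm of the (unique) bounded
functional that `φ` generates on `H^p`, and `∞` if there is none, i.e. if `φ` is not in the dual
space. -/
def hardyDualNorm {d : ℕ} (p : ℝ≥0∞) [Fact (1 ≤ p)] (φ : UnitAddTorus (Fin d) → ℂ) : ℝ≥0∞ :=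
  ⨅ (L : hardySpace d p →L[ℂ] ℂ) (_ : IsFunctionalOf φ L), ‖L‖ₑ

end HardyTorus

end

noncomputable section

namespace HardyTorus

/-! Write ψ = |φ|^{p-2}φ, which lies in L^q for the conjugate exponent q, and B = ‖φ‖_2^2.

(a) Up to a factor, ψ is the derivative of ‖·‖_p^p at φ. Minimality along φ + tf as t → 0 forces ⟨f,
ψ⟩ = 0 for every analytic polynomial f orthogonal to φ (`re_pairing_powDual_nonneg`,
`IsHilbertPoint.pairing_powDual_eq_zero`). Testing with two-term polynomials gives ψ^(α) = c φ^(α)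
on ℕ^d, and pairing ψ - cφ with φ gives ∫|φ|^p = conj(c) B, so c > 0. Conversely, if Pψ = λφ, then
⟨f, ψ⟩ = 0 whenever f is orthogonal to φ, hence ∫|φ|^p = ⟨φ + f, ψ⟩, and Young's inequality bounds
this by (1/p)∫|φ + f|^p + (1 - 1/p)∫|φ|^p.

Two points need care. For p = 1 the norm is differentiable at φ only if φ ≠ 0 almost everywhere;
`ae_ne_zero_of_analytic` supplies this through a Jensen-type inequality for the lexicographic order.
For p < 2, membership of φ in L^2 is a conclusion: ψ is in L^q ⊆ L^2, and φ^ = ψ^/c on ℕ^d.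

Orthogonality of f in L^p and h in L^q with disjoint spectra is obtained without any boundedness of
P: their correlation is a continuous function with zero Fourier coefficients, so it vanishes at the
origin.

(b) Any bounded L representing φ satisfies B = L(φ + f) ≤ ‖L‖ ‖φ + f‖ for f orthogonal to φ. If the
dual norm is B/‖φ‖, this says ‖φ‖ ≤ ‖φ + f‖. Conversely, a Hilbert point satisfies ‖φ‖ |⟨g, φ⟩| ≤ B
‖g‖ on H^p ∩ H^2, and Hahn-Banach extends the functional with the same bound. -/

/-! ### Fourier coefficients, correlations and uniqueness. -/

theorem mFourierCoeff_def {d : ℕ} (f : UnitAddTorus (Fin d) → ℂ) (α : Fin d → ℤ) :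
    mFourierCoeff f α = ∫ x, mFourier (-α) x * f x ∂haar d := rfl

theorem mFourier_apply_add {d : ℕ} (α : Fin d → ℤ) (x y : UnitAddTorus (Fin d)) :
    mFourier α (x + y) = mFourier α x * mFourier α y := by
  simp only [mFourier, ContinuousMap.coe_mk, ← Finset.prod_mul_distrib]
  refine Finset.prod_congr rfl fun i _ => ?_
  simp [fourier_apply, smul_add, AddCircle.toCircle_add]

theorem mFourier_neg_mul_self {d : ℕ} (α : Fin d → ℤ) (x : UnitAddTorus (Fin d)) :
    mFourier (-α) x * mFourier α x = 1 := by
  rw [← mFourier_add, neg_add_cancel, mFourier_zero, ContinuousMap.one_apply]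

theorem mFourierCoeff_mFourier_mul {d : ℕ} (f : UnitAddTorus (Fin d) → ℂ) (α β : Fin d → ℤ) :
    mFourierCoeff (fun x => mFourier α x * f x) β = mFourierCoeff f (β - α) := by
  rw [mFourierCoeff_def, mFourierCoeff_def, show -(β - α) = -β + α by abel]
  simp only [← mul_assoc, ← mFourier_add]

theorem integrable_bdd_mul {d : ℕ} {f : UnitAddTorus (Fin d) → ℂ} (hf : Integrable f (haar d))
    (g : C(UnitAddTorus (Fin d), ℂ)) : Integrable (fun x => g x * f x) (haar d) :=
  hf.bdd_mul g.continuous.aestronglyMeasurable (.of_forall g.norm_coe_le_norm)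

theorem eq_zero_of_mFourierCoeff_eq_zero {d : ℕ} (F : C(UnitAddTorus (Fin d), ℂ))
    (h : ∀ α, mFourierCoeff F α = 0) : F = 0 := by
  have h0 : mFourierCoeff F = 0 := funext h
  have hs := hasSum_mFourier_series_of_summable (f := F) (by rw [h0]; exact summable_zero)
  refine hs.unique ?_
  convert hasSum_zero with α
  rw [h]
  exact zero_smul ℂ (mFourier α)

theorem conj_mFourierCoeff {d : ℕ} (h : UnitAddTorus (Fin d) → ℂ) (α : Fin d → ℤ) :
    conj (mFourierCoeff h α) = ∫ x, mFourier α x * conj (h x) ∂haar d := by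
  rw [mFourierCoeff_def, ← integral_conj]
  simp [← mFourier_neg]

/-- The integral pairing with a function in `L^q`, as a bounded linear functional on `L^p`. -/
def dualPairing {d : ℕ} (p : ℝ≥0∞) {q : ℝ≥0∞} [Fact (1 ≤ p)] [Fact (1 ≤ q)] [p.HolderConjugate q]
    {h : UnitAddTorus (Fin d) → ℂ} (hh : MemLp h q (haar d)) : Lp ℂ p (haar d) →L[ℂ] ℂ :=
  ((ContinuousLinearMap.mul ℂ ℂ).lpPairing (haar d) p q).flip hh.star.toLp

theorem dualPairing_apply {d : ℕ} {p q : ℝ≥0∞} [Fact (1 ≤ p)] [Fact (1 ≤ q)] [p.HolderConjugate q]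
    {h : UnitAddTorus (Fin d) → ℂ} (hh : MemLp h q (haar d)) (f : Lp ℂ p (haar d)) :
    dualPairing p hh f = pairing f h := by
  rw [dualPairing, ContinuousLinearMap.flip_apply, ContinuousLinearMap.lpPairing_eq_integral]
  refine integral_congr_ae ?_
  filter_upwards [hh.star.coeFn_toLp] with x hx
  rw [hx]
  rfl

theorem integrable_mul_conj {d : ℕ} {p q : ℝ≥0∞} [p.HolderConjugate q]
    {f h : UnitAddTorus (Fin d) → ℂ} (hf : MemLp f p (haar d)) (hh : MemLp h q (haar d)) :
    Integrable (fun x => f x * conj (h x)) (haar d) :=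
  hf.integrable_mul hh.star

theorem pairing_congr {d : ℕ} {f f' g g' : UnitAddTorus (Fin d) → ℂ} (hf : f =ᵐ[haar d] f')
    (hg : g =ᵐ[haar d] g') : pairing f g = pairing f' g' := by
  refine integral_congr_ae ?_
  filter_upwards [hf, hg] with x h1 h2
  rw [h1, h2]

/-- Translation is continuous in L^p for p < ∞, and pairing with h is a bounded functional on L^p.
-/
theorem continuous_correlation {d : ℕ} {p q : ℝ≥0∞} [Fact (1 ≤ p)] [Fact (1 ≤ q)]
    [p.HolderConjugate q] (hp : p ≠ ∞) {f h : UnitAddTorus (Fin d) → ℂ}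
    (hf : MemLp f p (haar d)) (hh : MemLp h q (haar d)) :
    Continuous fun y => ∫ x, f (x + y) * conj (h x) ∂haar d := by
  let T : C(UnitAddTorus (Fin d), C(UnitAddTorus (Fin d), UnitAddTorus (Fin d))) :=
    ContinuousMap.curry ⟨fun z => z.2 + z.1, by fun_prop⟩
  have hT : ∀ y, MeasurePreserving (T y) (haar d) (haar d) := fun y =>
    measurePreserving_add_right (haar d) y
  have hc := (dualPairing p hh).continuous.comp
    ((continuous_const (y := hf.toLp)).compMeasurePreservingLp T.continuous hT hp)
  refine hc.congr fun y => ?_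
  rw [Function.comp_apply, dualPairing_apply]
  refine integral_congr_ae ?_
  filter_upwards [Lp.coeFn_compMeasurePreserving hf.toLp (hT y),
    (hT y).quasiMeasurePreserving.ae hf.coeFn_toLp] with x h1 h2
  rw [h1, Function.comp_apply, h2]
  rfl

/-- Fubini and translation invariance. Integrability on the product comes from the
measure-preserving shear (x, y) ↦ (x, x + y). -/
theorem mFourierCoeff_correlation {d : ℕ} {f h : UnitAddTorus (Fin d) → ℂ}
    (hf : Integrable f (haar d)) (hh : Integrable h (haar d)) (α : Fin d → ℤ) :
    mFourierCoeff (fun y => ∫ x, f (x + y) * conj (h x) ∂haar d) α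
      = mFourierCoeff f α * conj (mFourierCoeff h α) := by
  have hstar : Integrable (fun x => conj (h x)) (haar d) :=
    memLp_one_iff_integrable.1 (memLp_one_iff_integrable.2 hh).star
  have hprod : Integrable (fun z : UnitAddTorus (Fin d) × UnitAddTorus (Fin d) =>
      f (z.1 + z.2) * conj (h z.1)) ((haar d).prod (haar d)) := by
    have := (measurePreserving_prod_add (haar d) (haar d)).integrable_comp_of_integrable
      (hstar.mul_prod hf)
    refine this.congr (.of_forall fun z => ?_)
    simp [mul_comm]
  have hprod' : Integrable (fun z : UnitAddTorus (Fin d) × UnitAddTorus (Fin d) =>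
      mFourier (-α) z.2 * (f (z.1 + z.2) * conj (h z.1))) ((haar d).prod (haar d)) := by
    refine hprod.bdd_mul (c := 1) (by fun_prop) (.of_forall fun z => ?_)
    exact ((mFourier (-α)).norm_coe_le_norm z.2).trans mFourier_norm.le
  have hinner : ∀ x, ∫ y, mFourier (-α) y * f (x + y) ∂haar d
      = mFourier α x * mFourierCoeff f α := by
    intro x
    rw [mFourierCoeff_def, ← integral_const_mul,
      ← integral_add_left_eq_self (μ := haar d) (fun y => mFourier α x * (mFourier (-α) y * f y)) x]
    congr 1 with y
    rw [mFourier_apply_add]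
    linear_combination (-mFourier (-α) y * f (x + y)) * mFourier_neg_mul_self α x
  rw [mFourierCoeff_def]
  simp_rw [← integral_const_mul]
  rw [← integral_integral_swap hprod', conj_mFourierCoeff, ← integral_const_mul]
  congr 1 with x
  calc ∫ y, mFourier (-α) y * (f (x + y) * conj (h x)) ∂haar d
      = ∫ y, mFourier (-α) y * f (x + y) * conj (h x) ∂haar d := by simp only [mul_assoc]
    _ = _ := by rw [integral_mul_const, hinner]; ring

/-- If the Fourier coefficients of `f ∈ L^p` and `h ∈ L^q` have disjoint supports, then `f` and `h`
are orthogonal. -/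
theorem pairing_eq_zero_of_mFourierCoeff {d : ℕ} {p q : ℝ≥0∞} [hp1 : Fact (1 ≤ p)]
    [hq1 : Fact (1 ≤ q)] [p.HolderConjugate q] (hp : p ≠ ∞) {f h : UnitAddTorus (Fin d) → ℂ}
    (hf : MemLp f p (haar d)) (hh : MemLp h q (haar d))
    (H : ∀ α, mFourierCoeff f α * conj (mFourierCoeff h α) = 0) : pairing f h = 0 := by
  have := eq_zero_of_mFourierCoeff_eq_zero ⟨_, continuous_correlation hp hf hh⟩ fun α =>
    (mFourierCoeff_correlation (hf.integrable hp1.out) (hh.integrable hq1.out) α).trans (H α)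
  simpa [pairing] using DFunLike.congr_fun this 0

/-- An integrable function is determined by its Fourier coefficients. -/
theorem ae_eq_zero_of_mFourierCoeff {d : ℕ} {f : UnitAddTorus (Fin d) → ℂ}
    (hf : Integrable f (haar d)) (H : ∀ α, mFourierCoeff f α = 0) : f =ᵐ[haar d] 0 := by
  have : Fact ((1 : ℝ≥0∞) ≤ ∞) := ⟨le_top⟩
  -- The test function is the bounded phase f/|f|, equal to 0 where f = 0; its pairing with f is
  -- ∫|f|.
  have hm : AEStronglyMeasurable (fun x => ((‖f x‖⁻¹ : ℝ) : ℂ) * f x) (haar d) :=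
    (Complex.continuous_ofReal.comp_aestronglyMeasurable
      hf.1.norm.aemeasurable.inv.aestronglyMeasurable).mul hf.1
  have hh : MemLp (fun x => ((‖f x‖⁻¹ : ℝ) : ℂ) * f x) ∞ (haar d) := by
    refine memLp_top_of_bound hm 1 (.of_forall fun x => ?_)
    rw [norm_mul, Complex.norm_real, norm_inv, norm_norm]
    exact inv_mul_le_one
  have h0 := pairing_eq_zero_of_mFourierCoeff (p := 1) ENNReal.one_ne_top
    (memLp_one_iff_integrable.2 hf) hh fun α => by rw [H α, zero_mul]
  have h1 : ∫ x, ‖f x‖ ∂haar d = 0 := by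
    rw [← Complex.ofReal_eq_zero, ← integral_complex_ofReal, ← h0, pairing]
    congr 1 with x
    rw [map_mul, Complex.conj_ofReal, mul_left_comm, Complex.mul_conj']
    by_cases hx : ‖f x‖ = 0
    · simp [hx]
    · push_cast
      field_simp
  rw [integral_eq_zero_iff_of_nonneg (fun x => norm_nonneg _) hf.norm] at h1
  filter_upwards [h1] with x hx
  simpa using hx
-- Lexicographic analyticity and almost everywhere nonvanishing.
/-- The Fourier coefficients of `f` vanish at the multi-indices that are negative in the
lexicographic order. -/
def IsLexAnalytic {d : ℕ} (f : UnitAddTorus (Fin d) → ℂ) : Prop :=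
  ∀ α : Fin d → ℤ, toLex α < 0 → mFourierCoeff f α = 0

/-- Multiplication by `g` preserves the integrable lexicographically analytic functions, and the
mean is multiplicative on such products. -/
def IsLexMultiplier {d : ℕ} (g : C(UnitAddTorus (Fin d), ℂ)) : Prop :=
  ∀ f : UnitAddTorus (Fin d) → ℂ, Integrable f (haar d) → IsLexAnalytic f →
    IsLexAnalytic (fun x => g x * f x) ∧
      mFourierCoeff (fun x => g x * f x) 0 = mFourierCoeff g 0 * mFourierCoeff f 0

theorem mFourierCoeff_zero_right {d : ℕ} (f : UnitAddTorus (Fin d) → ℂ) :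
    mFourierCoeff f 0 = ∫ x, f x ∂haar d := by
  simp [mFourierCoeff_def, mFourier_zero]

theorem integrable_continuousMap {d : ℕ} (g : C(UnitAddTorus (Fin d), ℂ)) :
    Integrable g (haar d) := by
  simpa using integrable_bdd_mul (integrable_const (1 : ℂ)) g

theorem mFourierCoeff_mFourier {d : ℕ} (n α : Fin d → ℤ) :
    mFourierCoeff (mFourier n) α = if n = α then 1 else 0 := by
  rw [← mFourierCoeff_monomial 1,
    mFourierCoeff_congr (ContinuousMap.coeFn_toLp (haar d) (mFourier n))]

namespace IsLexMultiplier

variable {d : ℕ} {g h : C(UnitAddTorus (Fin d), ℂ)}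

theorem add (hg : IsLexMultiplier g) (hh : IsLexMultiplier h) : IsLexMultiplier (g + h) := by
  intro f hf hfa
  have key : ∀ α, mFourierCoeff (fun x => (g + h) x * f x) α
      = mFourierCoeff (fun x => g x * f x) α + mFourierCoeff (fun x => h x * f x) α := by
    intro α
    rw [← mFourierCoeff_add (integrable_bdd_mul hf g) (integrable_bdd_mul hf h)]
    congr 1 with x
    simp [add_mul]
  refine ⟨fun α hα => ?_, ?_⟩
  · rw [key, (hg f hf hfa).1 α hα, (hh f hf hfa).1 α hα, add_zero]
  · rw [key, (hg f hf hfa).2, (hh f hf hfa).2, ContinuousMap.coe_add,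
      mFourierCoeff_add (integrable_continuousMap g) (integrable_continuousMap h),
      add_mul]

theorem const_smul (c : ℂ) (hg : IsLexMultiplier g) : IsLexMultiplier (c • g) := by
  intro f hf hfa
  have key : (fun x => (c • g) x * f x) = c • fun x => g x * f x := by
    ext x
    simp [mul_assoc]
  rw [key]
  refine ⟨fun α hα => ?_, ?_⟩
  · rw [mFourierCoeff_const_smul, (hg f hf hfa).1 α hα, mul_zero]
  · rw [mFourierCoeff_const_smul, (hg f hf hfa).2, ContinuousMap.coe_smul,
      mFourierCoeff_const_smul, mul_assoc]

theorem mFourier {α : Fin d → ℤ} (hα : 0 ≤ toLex α) : IsLexMultiplier (mFourier α) := by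
  intro f hf hfa
  refine ⟨fun β hβ => ?_, ?_⟩
  · rw [mFourierCoeff_mFourier_mul]
    refine hfa _ ?_
    rw [toLex_sub]
    exact sub_neg.2 (hβ.trans_le hα)
  · rw [mFourierCoeff_mFourier_mul, mFourierCoeff_mFourier]
    split_ifs with h0
    · rw [h0, sub_zero, one_mul]
    · rw [zero_mul]
      refine hfa _ ?_
      rw [zero_sub, toLex_neg, neg_lt_zero]
      exact lt_of_le_of_ne hα fun h => h0 (toLex.injective h.symm)

theorem mFourierCoeff_pow_mul (hg : IsLexMultiplier g) (n : ℕ) {f : UnitAddTorus (Fin d) → ℂ}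
    (hf : Integrable f (haar d)) (hfa : IsLexAnalytic f) :
    IsLexAnalytic (fun x => g x ^ n * f x) ∧
      mFourierCoeff (fun x => g x ^ n * f x) 0 = mFourierCoeff g 0 ^ n * mFourierCoeff f 0 := by
  induction n with
  | zero => simpa using hfa
  | succ n ih =>
    have := hg _ (integrable_bdd_mul hf (g ^ n)) ih.1
    simp only [ContinuousMap.pow_apply, ← mul_assoc, ← pow_succ'] at this
    exact ⟨this.1, by rw [this.2, ih.2, pow_succ', mul_assoc]⟩

theorem integral_exp_mul (hg : IsLexMultiplier g) {f : UnitAddTorus (Fin d) → ℂ}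
    (hf : Integrable f (haar d)) (hfa : IsLexAnalytic f) :
    ∫ x, Complex.exp (g x) * f x ∂haar d
      = Complex.exp (∫ x, g x ∂haar d) * ∫ x, f x ∂haar d := by
  have hexp : ∀ z : ℂ, HasSum (fun n : ℕ => (n.factorial : ℂ)⁻¹ * z ^ n) (Complex.exp z) := by
    intro z
    rw [Complex.exp_eq_exp_ℂ]
    simpa [div_eq_inv_mul] using NormedSpace.exp_series_hasSum_exp' (𝕂 := ℂ) z
  have h1 : HasSum (fun n : ℕ => ∫ x, (n.factorial : ℂ)⁻¹ * (g x ^ n * f x) ∂haar d)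
      (∫ x, Complex.exp (g x) * f x ∂haar d) := by
    refine hasSum_integral_of_dominated_convergence
      (fun n x => (n.factorial : ℝ)⁻¹ * ‖g‖ ^ n * ‖f x‖) (fun n => ?_) (fun n => ?_) ?_ ?_ ?_
    · exact ((integrable_bdd_mul hf (g ^ n)).const_mul _).1
    · refine .of_forall fun x => ?_
      rw [norm_mul, norm_mul, norm_pow, norm_inv, Complex.norm_natCast, ← mul_assoc]
      gcongr
      exact g.norm_coe_le_norm x
    · refine .of_forall fun x => Summable.mul_right _ ?_
      simpa [div_eq_inv_mul] using Real.summable_pow_div_factorial ‖g‖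
    · simp_rw [tsum_mul_right]
      exact hf.norm.const_mul _
    · refine .of_forall fun x => ?_
      simpa only [mul_assoc] using (hexp (g x)).mul_right (f x)
  refine h1.unique ?_
  have h2 := (hexp (∫ x, g x ∂haar d)).mul_right (∫ x, f x ∂haar d)
  refine h2.congr_fun fun n => ?_
  have := (hg.mFourierCoeff_pow_mul n hf hfa).2
  simp only [mFourierCoeff_zero_right] at this
  rw [integral_const_mul, this, mul_assoc]

end IsLexMultiplier

/-- A lexicographically negative term c z^α has the same real part as conj(c) z^{-α}. Since this
reflection is not complex linear, the scalar c is carried through the induction. -/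
theorem exists_isLexMultiplier_re_eq {d : ℕ} {q : C(UnitAddTorus (Fin d), ℂ)}
    (hq : q ∈ Submodule.span ℂ (Set.range (mFourier (d := Fin d)))) (c : ℂ) :
    ∃ g, IsLexMultiplier g ∧ ∀ x, (g x).re = (c * q x).re := by
  induction hq using Submodule.span_induction generalizing c with
  | mem q hq =>
    obtain ⟨α, rfl⟩ := hq
    rcases le_total 0 (toLex α) with h | h
    · exact ⟨c • mFourier α, .const_smul c (.mFourier h), fun x => by simp⟩
    · refine ⟨conj c • mFourier (-α), .const_smul _ (.mFourier ?_), fun x => ?_⟩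
      · rw [toLex_neg]
        exact neg_nonneg.2 h
      · rw [ContinuousMap.smul_apply, mFourier_neg, smul_eq_mul, ← map_mul, Complex.conj_re]
  | zero => exact ⟨(0 : ℂ) • mFourier 0, .const_smul _ (.mFourier le_rfl), fun x => by simp⟩
  | add q r _ _ hq hr =>
    obtain ⟨g, hg, hg'⟩ := hq c
    obtain ⟨h, hh, hh'⟩ := hr c
    exact ⟨g + h, hg.add hh, fun x => by simp [mul_add, hg', hh']⟩
  | smul a q _ hq =>
    obtain ⟨g, hg, hg'⟩ := hq (c * a)
    exact ⟨g, hg, fun x => by simp [hg', mul_assoc]⟩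

/-- A weak form of Jensen's inequality for lexicographically analytic functions. -/
theorem norm_integral_mul_exp_le {d : ℕ} {f : UnitAddTorus (Fin d) → ℂ}
    (hf : Integrable f (haar d)) (hfa : IsLexAnalytic f) (u : C(UnitAddTorus (Fin d), ℝ)) :
    ‖∫ x, f x ∂haar d‖ * Real.exp (∫ x, u x ∂haar d)
      ≤ Real.exp 2 * ∫ x, Real.exp (u x) * ‖f x‖ ∂haar d := by
  let U : C(UnitAddTorus (Fin d), ℂ) := ⟨fun x => (u x : ℂ), by fun_prop⟩
  have hU : U ∈ closure (Submodule.span ℂ (Set.range (mFourier (d := Fin d))) :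
      Set C(UnitAddTorus (Fin d), ℂ)) := by
    rw [← Submodule.topologicalClosure_coe, span_mFourier_closure_eq_top]
    trivial
  -- Distance 1 suffices: replacing u by Re g costs one factor e in the mean and one in the
  -- integrand, hence the constant e^2.
  obtain ⟨q, hq, hqU⟩ := Metric.mem_closure_iff.1 hU 1 one_pos
  obtain ⟨g, hg, hgq⟩ := exists_isLexMultiplier_re_eq hq 1
  have hclose : ∀ x, |u x - (g x).re| ≤ 1 := by
    intro x
    have h1 := (ContinuousMap.dist_apply_le_dist (f := U) (g := q) x).trans hqU.le
    rw [dist_eq_norm] at h1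
    have h2 := (Complex.abs_re_le_norm _).trans h1
    rw [hgq, one_mul]
    simpa [U] using h2
  have hui : Integrable u (haar d) := by
    have := (integrable_continuousMap U).re
    simpa [U] using this
  have hint : ∫ x, u x ∂haar d - 1 ≤ (∫ x, g x ∂haar d).re := by
    rw [← RCLike.re_to_complex, ← integral_re (integrable_continuousMap g)]
    have : ∫ x, (u x - 1) ∂haar d = ∫ x, u x ∂haar d - 1 := by
      rw [integral_sub hui (integrable_const _)]
      simp
    rw [← this]
    refine integral_mono (hui.sub (integrable_const _)) (integrable_continuousMap g).re
      fun x => ?_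
    have := (abs_le.1 (hclose x)).2
    simp only [RCLike.re_to_complex]
    linarith
  have hexpi : Integrable (fun x => Real.exp (u x) * ‖f x‖) (haar d) := by
    have := (integrable_bdd_mul hf ⟨fun x => Complex.exp (u x), by fun_prop⟩).norm
    simpa [Complex.norm_exp] using this
  have hle : ‖∫ x, Complex.exp (g x) * f x ∂haar d‖
      ≤ Real.exp 1 * ∫ x, Real.exp (u x) * ‖f x‖ ∂haar d := by
    rw [← integral_const_mul]
    refine norm_integral_le_of_norm_le (hexpi.const_mul _) (.of_forall fun x => ?_)
    rw [norm_mul, Complex.norm_exp, ← mul_assoc, ← Real.exp_add]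
    gcongr
    have := (abs_le.1 (hclose x)).1
    linarith
  rw [hg.integral_exp_mul hf hfa, norm_mul, Complex.norm_exp] at hle
  calc ‖∫ x, f x ∂haar d‖ * Real.exp (∫ x, u x ∂haar d)
      ≤ ‖∫ x, f x ∂haar d‖ * Real.exp (1 + (∫ x, g x ∂haar d).re) := by
        gcongr
        linarith
    _ = Real.exp 1 * (Real.exp (∫ x, g x ∂haar d).re * ‖∫ x, f x ∂haar d‖) := by
        rw [Real.exp_add]
        ring
    _ ≤ Real.exp 1 * (Real.exp 1 * ∫ x, Real.exp (u x) * ‖f x‖ ∂haar d) := by gcongr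
    _ = _ := by rw [← mul_assoc, ← Real.exp_add]; norm_num

/-- Put u = N·1_K in the Jensen-type inequality. As f = 0 on K, the right side does not feel the
weight, while the left side grows like e^{N m(K)}. -/
theorem integral_eq_zero_of_isLexAnalytic {d : ℕ} {f : UnitAddTorus (Fin d) → ℂ}
    (hf : Integrable f (haar d)) (hfa : IsLexAnalytic f) {K : Set (UnitAddTorus (Fin d))}
    (hK : IsClosed K) (hK0 : haar d K ≠ 0) (hfK : ∀ x ∈ K, f x = 0) :
    ∫ x, f x ∂haar d = 0 := by
  have hm : 0 < (haar d).real K := ENNReal.toReal_pos hK0 (measure_ne_top _ _)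
  have key : ∀ N : ℕ, ‖∫ x, f x ∂haar d‖ * Real.exp (N * (haar d).real K)
      ≤ Real.exp 2 * ∫ x, ‖f x‖ ∂haar d := by
    intro N
    have hδ : ∀ n : ℕ, (0 : ℝ) < 1 / (n + 1) := fun n => Nat.one_div_pos_of_nat
    -- The inequality needs a continuous weight, so 1_K is approached from above by thickened
    -- indicators.
    let v : ℕ → UnitAddTorus (Fin d) → ℝ := fun n x => thickenedIndicator (hδ n) K x
    have hvc : ∀ n, Continuous (v n) := fun n =>
      NNReal.continuous_coe.comp (thickenedIndicator (hδ n) K).continuous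
    have hv1 : ∀ n x, v n x ≤ 1 := fun n x => by
      exact NNReal.coe_le_one.2 (thickenedIndicator_le_one (hδ n) K x)
    have hvK : ∀ n, (haar d).real K ≤ ∫ x, v n x ∂haar d := by
      intro n
      rw [← integral_indicator_one hK.measurableSet]
      refine integral_mono ((integrable_const (1 : ℝ)).indicator hK.measurableSet)
        ?_ fun x => ?_
      · exact (integrable_const (1 : ℝ)).mono' (hvc n).aestronglyMeasurable
          (.of_forall fun x => by
            rw [Real.norm_of_nonneg (NNReal.coe_nonneg _)]
            exact hv1 n x)
      · by_cases hx : x ∈ K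
        · simp only [v, thickenedIndicator_one (hδ n) K hx]
          simp [hx]
        · simp [hx, v]
    have hlim : Filter.Tendsto (fun n => ∫ x, Real.exp (N * v n x) * ‖f x‖ ∂haar d)
        Filter.atTop (nhds (∫ x, ‖f x‖ ∂haar d)) := by
      refine tendsto_integral_of_dominated_convergence (fun x => Real.exp N * ‖f x‖)
        (fun n => ?_) (hf.norm.const_mul _) (fun n => .of_forall fun x => ?_)
        (.of_forall fun x => ?_)
      · exact (Continuous.aestronglyMeasurable
          (Real.continuous_exp.comp (continuous_const.mul (hvc n)))).mul hf.1.norm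
      · rw [norm_mul, norm_norm, Real.norm_eq_abs, Real.abs_exp]
        gcongr
        exact mul_le_of_le_one_right N.cast_nonneg (hv1 n x)
      · by_cases hx : x ∈ K
        · simp [hfK x hx]
        · have h1 := (tendsto_pi_nhds.1 (thickenedIndicator_tendsto_indicator_closure hδ
            tendsto_one_div_add_atTop_nhds_zero_nat K)) x
          rw [hK.closure_eq, Set.indicator_of_notMem hx] at h1
          have h2 : Filter.Tendsto (fun n => v n x) Filter.atTop (nhds 0) := by
            simpa [v] using NNReal.tendsto_coe.2 h1
          have h3 := ((Real.continuous_exp.tendsto _).comp (h2.const_mul (N : ℝ))).mul_const ‖f x‖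
          simpa using h3
    refine ge_of_tendsto' (hlim.const_mul _) fun n => ?_
    refine le_trans ?_ (norm_integral_mul_exp_le hf hfa
      ⟨fun x => N * v n x, continuous_const.mul (hvc n)⟩)
    gcongr
    simp only [ContinuousMap.coe_mk]
    rw [integral_const_mul]
    gcongr
    exact hvK n
  by_contra h0
  have hpos : 0 < ‖∫ x, f x ∂haar d‖ := norm_pos_iff.2 h0
  have ht : Filter.Tendsto (fun N : ℕ => ‖∫ x, f x ∂haar d‖ * Real.exp (N * (haar d).real K))
      Filter.atTop Filter.atTop :=
    (Real.tendsto_exp_atTop.comp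
      (tendsto_natCast_atTop_atTop.atTop_mul_const hm)).const_mul_atTop hpos
  obtain ⟨N, hN⟩ := (ht.eventually_gt_atTop _).exists
  exact absurd (key N) (not_le.2 hN)

/-- A nonzero integrable function on the torus with Fourier coefficients supported in `ℕ ^ d` is
nonzero almost everywhere. -/
theorem ae_ne_zero_of_analytic {d : ℕ} {f : UnitAddTorus (Fin d) → ℂ}
    (hf : Integrable f (haar d)) (hfa : ∀ α : Fin d → ℤ, ¬ 0 ≤ α → mFourierCoeff f α = 0)
    (hf0 : ¬ f =ᵐ[haar d] 0) : ∀ᵐ x ∂haar d, f x ≠ 0 := by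
  let e : (Fin d → ℕ) → Lex (Fin d → ℤ) := fun n => toLex fun i => (n i : ℤ)
  have he : Monotone e := fun m n hmn =>
    Pi.toLex_monotone fun i => Int.ofNat_le.2 (hmn i)
  let S : Set (Lex (Fin d → ℤ)) := {a | mFourierCoeff f (ofLex a) ≠ 0}
  have hSe : S ⊆ e '' Set.univ := by
    intro a ha
    have hpos : 0 ≤ ofLex a := by
      by_contra h
      exact ha (hfa _ h)
    refine ⟨fun i => (ofLex a i).toNat, trivial, ?_⟩
    refine ofLex.injective (funext fun i => ?_)
    exact Int.toNat_of_nonneg (hpos i)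
  have hS : S.Nonempty := by
    by_contra h
    rw [Set.not_nonempty_iff_eq_empty] at h
    refine hf0 (ae_eq_zero_of_mFourierCoeff hf fun α => ?_)
    by_contra hα
    have : toLex α ∈ S := hα
    simp [h] at this
  -- By Dickson's lemma ℕ^d is well-quasi-ordered, and the lexicographic order refines the product
  -- order, so the spectrum has a least element. Dividing f by that monomial gives a
  -- lexicographically analytic function of nonzero mean.
  have hwf : S.IsWF :=
    (((Set.isPWO_of_wellQuasiOrderedLE Set.univ).image_of_monotone he).mono hSe).isWF
  set a := hwf.min hS
  have haS : a ∈ S := hwf.min_mem hS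
  let F : UnitAddTorus (Fin d) → ℂ := fun x => mFourier (-ofLex a) x * f x
  have hFi : Integrable F (haar d) := integrable_bdd_mul hf _
  have hF : IsLexAnalytic F := by
    intro α hα
    rw [mFourierCoeff_mFourier_mul]
    by_contra h
    have h1 : a ≤ toLex (α - -ofLex a) := hwf.min_le hS h
    rw [sub_neg_eq_add, toLex_add, toLex_ofLex] at h1
    exact absurd h1 (not_le.2 (add_lt_of_neg_left _ hα))
  have hF0 : ∫ x, F x ∂haar d ≠ 0 := by
    rw [← mFourierCoeff_zero_right, mFourierCoeff_mFourier_mul, zero_sub, neg_neg]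
    exact haS
  by_contra hne
  rw [ae_iff] at hne
  simp only [ne_eq, not_not] at hne
  have hnull : NullMeasurableSet {x | f x = 0} (haar d) :=
    hf.1.aemeasurable.nullMeasurableSet_preimage (measurableSet_singleton 0)
  -- Inner regularity places a compact set of positive measure inside the zero set.
  obtain ⟨t, hts, htm, hte⟩ := hnull.exists_measurable_subset_ae_eq
  rw [← measure_congr hte] at hne
  obtain ⟨K, hKt, hK, hKpos⟩ := htm.exists_lt_isCompact (pos_iff_ne_zero.2 hne)
  refine hF0 (integral_eq_zero_of_isLexAnalytic hFi hF hK.isClosed hKpos.ne' fun x hx => ?_)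
  have : f x = 0 := hts (hKt hx)
  simp [F, this]
-- The duality map and the first variation of the norm.
/-- The function `z ↦ |z| ^ (r - 2) z`, with value `0` at `0`. -/
def powDual (r : ℝ) (z : ℂ) : ℂ := ((‖z‖ ^ (r - 2) : ℝ) : ℂ) * z

theorem norm_powDual {r : ℝ} {z : ℂ} (hz : z ≠ 0) : ‖powDual r z‖ = ‖z‖ ^ (r - 1) := by
  rw [powDual, norm_mul, Complex.norm_real, Real.norm_of_nonneg (by positivity),
    ← Real.rpow_add_one (norm_ne_zero_iff.2 hz)]
  ring_nf

/-- Only an inequality: at z = 0 and r = 1 the right side is 0^0 = 1. -/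
theorem norm_powDual_le (r : ℝ) (z : ℂ) : ‖powDual r z‖ ≤ ‖z‖ ^ (r - 1) := by
  by_cases hz : z = 0
  · simp only [hz, powDual, mul_zero, norm_zero]
    positivity
  · exact (norm_powDual hz).le

theorem mul_rpow_sub_one {r s : ℝ} (hr : 1 ≤ r) (hs : 0 ≤ s) : s * s ^ (r - 1) = s ^ r := by
  rw [← Real.rpow_one_add' hs (by linarith)]
  ring_nf

theorem mul_conj_powDual {r : ℝ} (hr : 1 ≤ r) (z : ℂ) :
    z * conj (powDual r z) = ((‖z‖ ^ r : ℝ) : ℂ) := by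
  by_cases hz : z = 0
  · simp [hz, powDual, Real.zero_rpow (by linarith : r ≠ 0)]
  · have h0 : ‖z‖ ≠ 0 := norm_ne_zero_iff.2 hz
    rw [powDual, map_mul, Complex.conj_ofReal, mul_left_comm, Complex.mul_conj']
    norm_cast
    rw [← Real.rpow_natCast, ← Real.rpow_add (norm_pos_iff.2 hz)]
    norm_num

theorem measurable_powDual (r : ℝ) : Measurable (powDual r) := by
  unfold powDual
  fun_prop

/-- Young's inequality for |a| |w|^{r-1}. The case r = 1 is separate, as the conjugate exponent is
then infinite. -/
theorem norm_mul_norm_powDual_le {r : ℝ} (hr : 1 ≤ r) (a w : ℂ) :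
    ‖a‖ * ‖powDual r w‖ ≤ 1 / r * ‖a‖ ^ r + (1 - 1 / r) * ‖w‖ ^ r := by
  refine (mul_le_mul_of_nonneg_left (norm_powDual_le r w) (norm_nonneg a)).trans ?_
  rcases hr.eq_or_lt with rfl | hr
  · simp
  · have hc := Real.HolderConjugate.conjExponent hr
    refine (Real.young_inequality_of_nonneg (norm_nonneg a) (by positivity) hc).trans_eq ?_
    have h1 : (r - 1) * r.conjExponent = r := by
      rw [Real.conjExponent, mul_div_cancel₀ _ (by linarith)]
    have h2 : 1 - 1 / r = 1 / r.conjExponent := by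
      have := hc.inv_add_inv_eq_one
      simp only [one_div]
      linarith
    rw [← Real.rpow_mul (norm_nonneg w), h1, h2]
    ring

/-- The tangent inequality for the convex function `|z| ^ r`. -/
theorem norm_rpow_sub_le {r : ℝ} (hr : 1 ≤ r) (a w : ℂ) :
    ‖w‖ ^ r - ‖a‖ ^ r ≤ r * ((w - a) * conj (powDual r w)).re := by
  have h1 := norm_mul_norm_powDual_le hr a w
  have h2 : (a * conj (powDual r w)).re ≤ ‖a‖ * ‖powDual r w‖ := by
    refine (Complex.re_le_norm _).trans_eq ?_
    rw [norm_mul, RCLike.norm_conj]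
  rw [sub_mul, mul_conj_powDual hr, Complex.sub_re, Complex.ofReal_re]
  have h3 := mul_le_mul_of_nonneg_left (h2.trans h1) (by linarith : 0 ≤ r)
  have h4 : r * (1 / r * ‖a‖ ^ r + (1 - 1 / r) * ‖w‖ ^ r)
      = ‖a‖ ^ r + r * ‖w‖ ^ r - ‖w‖ ^ r := by
    field_simp
    ring
  linarith

theorem continuousAt_powDual {r : ℝ} (hr : 1 ≤ r) {z : ℂ} (hz : r = 1 → z ≠ 0) :
    ContinuousAt (powDual r) z := by
  by_cases h0 : z = 0
  · have hr1 : 1 < r := lt_of_le_of_ne hr fun h => hz h.symm h0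
    subst h0
    have hp : powDual r 0 = 0 := by simp [powDual]
    rw [ContinuousAt, hp]
    refine squeeze_zero_norm (norm_powDual_le r) ?_
    have : ContinuousAt (fun z : ℂ => ‖z‖ ^ (r - 1)) 0 :=
      continuous_norm.continuousAt.rpow_const (.inr (by linarith))
    have h2 := this.tendsto
    rwa [norm_zero, Real.zero_rpow (by linarith)] at h2
  · unfold powDual
    refine ContinuousAt.mul (Complex.continuous_ofReal.continuousAt.comp ?_) continuousAt_id
    exact continuous_norm.continuousAt.rpow_const (.inl (norm_ne_zero_iff.2 h0))

section

variable {d : ℕ} {p q : ℝ≥0∞} [hp1 : Fact (1 ≤ p)] [p.HolderConjugate q]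

theorem one_le_toReal (hp : p ≠ ∞) : 1 ≤ p.toReal := by
  simpa using ENNReal.toReal_mono hp hp1.out

theorem memLp_powDual (hp : p ≠ ∞) {u : UnitAddTorus (Fin d) → ℂ} (hu : MemLp u p (haar d)) :
    MemLp (fun x => powDual p.toReal (u x)) q (haar d) := by
  have hm : AEStronglyMeasurable (fun x => powDual p.toReal (u x)) (haar d) :=
    ((measurable_powDual _).comp_aemeasurable hu.1.aemeasurable).aestronglyMeasurable
  by_cases hp1' : p = 1
  · subst hp1'
    have hq : q = ∞ := ENNReal.HolderConjugate.unique 1 q ∞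
    subst hq
    refine memLp_top_of_bound hm 1 (.of_forall fun x => (norm_powDual_le _ _).trans ?_)
    simp
  · have hq : q ≠ ∞ := by
      rwa [ENNReal.HolderConjugate.ne_top_iff_ne_one q p]
    have hr : 1 < p.toReal := by
      rw [← ENNReal.toReal_one]
      exact (ENNReal.toReal_lt_toReal ENNReal.one_ne_top hp).2
        (lt_of_le_of_ne hp1.out (Ne.symm hp1'))
    have hc : p.toReal.HolderConjugate q.toReal := ENNReal.HolderConjugate.toReal hr
    rw [← integrable_norm_rpow_iff hm (ENNReal.HolderConjugate.ne_zero q p) hq]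
    refine (hu.integrable_norm_rpow (zero_lt_one.trans_le hp1.out).ne' hp).congr (.of_forall fun x => ?_)
    have hq0 : q.toReal ≠ 0 := hc.symm.ne_zero
    by_cases hx : u x = 0
    · simp [hx, powDual, Real.zero_rpow hq0, Real.zero_rpow hc.ne_zero]
    · simp only
      rw [norm_powDual hx, ← Real.rpow_mul (norm_nonneg _), hc.sub_one_mul_conj]

theorem norm_le_norm_iff_integral (hp : p ≠ ∞) (u v : Lp ℂ p (haar d)) :
    ‖u‖ ≤ ‖v‖ ↔ ∫ x, ‖u x‖ ^ p.toReal ∂haar d ≤ ∫ x, ‖v x‖ ^ p.toReal ∂haar d := by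
  have hr := one_le_toReal hp
  have h : ∀ w : Lp ℂ p (haar d),
      ‖w‖ = (∫ x, ‖w x‖ ^ p.toReal ∂haar d) ^ p.toReal⁻¹ := by
    intro w
    rw [Lp.norm_def, (Lp.memLp w).eLpNorm_eq_integral_rpow_norm
      (zero_lt_one.trans_le hp1.out).ne' hp,
      ENNReal.toReal_ofReal (by positivity)]
  rw [h, h, Real.rpow_le_rpow_iff (by positivity) (by positivity) (by positivity)]

/-- One-sided first variation. The tangent inequality is applied at the moved point u + tf, so
minimality gives a sign for each t > 0 without differentiating under the integral; then t → 0. -/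
theorem re_pairing_powDual_nonneg (hp : p ≠ ∞) {u f : UnitAddTorus (Fin d) → ℂ}
    (hu : MemLp u p (haar d)) (hf : MemLp f p (haar d))
    (hu0 : p = 1 → ∀ᵐ x ∂haar d, u x ≠ 0)
    (h : ∀ t : ℝ, 0 < t → ∫ x, ‖u x‖ ^ p.toReal ∂haar d
      ≤ ∫ x, ‖u x + t * f x‖ ^ p.toReal ∂haar d) :
    0 ≤ (pairing f fun x => powDual p.toReal (u x)).re := by
  have hr := one_le_toReal hp
  have hp0 : p ≠ 0 := (zero_lt_one.trans_le hp1.out).ne'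
  have hw : ∀ t : ℝ, MemLp (fun x => u x + t * f x) p (haar d) := fun t =>
    hu.add (hf.const_mul (t : ℂ))
  have hnonneg : ∀ t : ℝ, 0 < t →
      0 ≤ (pairing f fun x => powDual p.toReal (u x + t * f x)).re := by
    intro t ht
    have hi := integrable_mul_conj (q := p.conjExponent) hf (memLp_powDual hp (hw t))
    have h1 : ∫ x, (‖u x + t * f x‖ ^ p.toReal - ‖u x‖ ^ p.toReal) ∂haar d
        ≤ ∫ x, p.toReal * t * (f x * conj (powDual p.toReal (u x + t * f x))).re ∂haar d := by
      refine integral_mono (((hw t).integrable_norm_rpow hp0 hp).sub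
        (hu.integrable_norm_rpow hp0 hp)) (hi.re.const_mul _) fun x => ?_
      refine (norm_rpow_sub_le hr (u x) (u x + t * f x)).trans_eq ?_
      rw [add_sub_cancel_left, mul_assoc (t : ℂ), Complex.re_ofReal_mul, mul_assoc]
    rw [integral_sub ((hw t).integrable_norm_rpow hp0 hp) (hu.integrable_norm_rpow hp0 hp),
      integral_const_mul] at h1
    have h2 : (pairing f fun x => powDual p.toReal (u x + t * f x)).re
        = ∫ x, (f x * conj (powDual p.toReal (u x + t * f x))).re ∂haar d := (integral_re hi).symm
    rw [h2]
    have h3 : 0 < p.toReal * t := by positivity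
    exact nonneg_of_mul_nonneg_right ((sub_nonneg.2 (h t ht)).trans h1) h3
  have hlim : Filter.Tendsto
      (fun n : ℕ => pairing f fun x => powDual p.toReal (u x + (1 / (n + 1) : ℝ) * f x))
      Filter.atTop (nhds (pairing f fun x => powDual p.toReal (u x))) := by
    -- The dominating function is (|u| + |f|)^p.
    have hs := (hu.norm.add hf.norm).integrable_norm_rpow hp0 hp
    refine tendsto_integral_of_dominated_convergence _
      (fun n => (integrable_mul_conj (q := p.conjExponent) hf (memLp_powDual hp (hw _))).1) hs
      (fun n => .of_forall fun x => ?_) ?_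
    · have h1 : ‖f x‖ ≤ ‖u x‖ + ‖f x‖ := by linarith [norm_nonneg (u x)]
      have h2 : ‖u x + (1 / (n + 1) : ℝ) * f x‖ ≤ ‖u x‖ + ‖f x‖ := by
        refine (norm_add_le _ _).trans (add_le_add le_rfl ?_)
        rw [norm_mul, Complex.norm_real, Real.norm_of_nonneg Nat.one_div_pos_of_nat.le]
        refine mul_le_of_le_one_left (norm_nonneg _) ?_
        rw [div_le_one (by positivity)]
        linarith [n.cast_nonneg (α := ℝ)]
      rw [norm_mul, RCLike.norm_conj, Pi.add_apply, Real.norm_of_nonneg (by positivity),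
        ← mul_rpow_sub_one hr (by positivity)]
      refine mul_le_mul h1 ((norm_powDual_le _ _).trans ?_) (norm_nonneg _) (by positivity)
      exact Real.rpow_le_rpow (norm_nonneg _) h2 (by linarith)
    -- The duality map is discontinuous only at 0 and only for p = 1.
    · have hae : ∀ᵐ x ∂haar d, p.toReal = 1 → u x ≠ 0 := by
        by_cases h1 : p = 1
        · filter_upwards [hu0 h1] with x hx _
          exact hx
        · refine .of_forall fun x hx => absurd ?_ h1
          rwa [← ENNReal.toReal_one, ENNReal.toReal_eq_toReal_iff' hp ENNReal.one_ne_top] at hx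
      filter_upwards [hae] with x hx
      have ht : Filter.Tendsto (fun n : ℕ => u x + (1 / (n + 1) : ℝ) * f x)
          Filter.atTop (nhds (u x)) := by
        have h0 := (Complex.continuous_ofReal.tendsto 0).comp
          (tendsto_one_div_add_atTop_nhds_zero_nat (𝕜 := ℝ))
        simpa using (h0.mul_const (f x)).const_add (u x)
      have h3 := ((continuousAt_powDual hr hx).tendsto.comp ht)
      exact ((Complex.continuous_conj.tendsto _).comp h3).const_mul (f x)
  exact ge_of_tendsto' ((Complex.continuous_re.tendsto _).comp hlim) fun n =>
    hnonneg _ Nat.one_div_pos_of_nat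

end
-- Part (a): Hilbert points and the Riesz projection.
/-- An integrable function with square summable Fourier coefficients is in `L^2`. -/
theorem memLp_two_of_norm_mFourierCoeff_le {d : ℕ} {f g : UnitAddTorus (Fin d) → ℂ}
    (hf : Integrable f (haar d)) (hg : MemLp g 2 (haar d)) (C : ℝ)
    (h : ∀ α, ‖mFourierCoeff f α‖ ≤ C * ‖mFourierCoeff g α‖) : MemLp f 2 (haar d) := by
  have hs : Summable fun α => ‖mFourierCoeff g α‖ ^ 2 := by
    have := (hasSum_sq_mFourierCoeff hg.toLp).summable
    refine this.congr fun α => ?_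
    rw [mFourierCoeff_congr hg.coeFn_toLp]
  have hm : Memℓp (fun α => mFourierCoeff f α) 2 := by
    refine memℓp_gen (Summable.of_nonneg_of_le (fun α => by positivity) (fun α => ?_)
      (hs.mul_left (C ^ 2)))
    rw [ENNReal.toReal_ofNat, Real.rpow_two, ← mul_pow]
    exact pow_le_pow_left₀ (norm_nonneg _) (h α) 2
  let F : Lp ℂ 2 (haar d) := mFourierBasis.repr.symm ⟨_, hm⟩
  have hF : ∀ α, mFourierCoeff F α = mFourierCoeff f α := by
    intro α
    rw [← mFourierBasis_repr]
    erw [LinearIsometryEquiv.apply_symm_apply]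
  have hFi : Integrable F (haar d) := (Lp.memLp F).integrable one_le_two
  have h0 := ae_eq_zero_of_mFourierCoeff (hf.add (hFi.const_mul (-1))) fun α => by
    have hsm : (fun x => (-1 : ℂ) * F x) = (-1 : ℂ) • (F : UnitAddTorus (Fin d) → ℂ) := rfl
    rw [mFourierCoeff_add hf (hFi.const_mul (-1)), hsm, mFourierCoeff_const_smul, hF]
    ring
  refine (Lp.memLp F).ae_eq ?_
  filter_upwards [h0] with x hx
  have : f x + -1 * F x = 0 := hx
  linear_combination -this

theorem pairing_smul_left {d : ℕ} {p : ℝ≥0∞} (c : ℂ) (f : Lp ℂ p (haar d)) (g : UnitAddTorus (Fin d) → ℂ) :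
    pairing (c • f : Lp ℂ p (haar d)) g = c * pairing f g := by
  rw [pairing, pairing, ← integral_const_mul]
  refine integral_congr_ae ?_
  filter_upwards [Lp.coeFn_smul c f] with x hx
  rw [hx, Pi.smul_apply, smul_eq_mul, mul_assoc]

section

variable {d : ℕ} {p : ℝ≥0∞} [hp1 : Fact (1 ≤ p)]

theorem pairing_monomial_sub {g : UnitAddTorus (Fin d) → ℂ} (hg : Integrable g (haar d))
    (a b : ℂ) (α β : Fin d → ℤ) :
    pairing (a • ContinuousMap.toLp (E := ℂ) p (haar d) ℂ (mFourier α)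
        - b • ContinuousMap.toLp (E := ℂ) p (haar d) ℂ (mFourier β) : Lp ℂ p (haar d)) g
      = a * conj (mFourierCoeff g α) - b * conj (mFourierCoeff g β) := by
  have hg' : Integrable (fun x => conj (g x)) (haar d) :=
    memLp_one_iff_integrable.1 (memLp_one_iff_integrable.2 hg).star
  rw [conj_mFourierCoeff, conj_mFourierCoeff, ← integral_const_mul, ← integral_const_mul,
    ← integral_sub ((integrable_bdd_mul hg' _).const_mul _)
      ((integrable_bdd_mul hg' _).const_mul _)]
  refine integral_congr_ae ?_
  filter_upwards [Lp.coeFn_sub (a • ContinuousMap.toLp (E := ℂ) p (haar d) ℂ (mFourier α))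
    (b • ContinuousMap.toLp (E := ℂ) p (haar d) ℂ (mFourier β)),
    Lp.coeFn_smul a (ContinuousMap.toLp (E := ℂ) p (haar d) ℂ (mFourier α)),
    Lp.coeFn_smul b (ContinuousMap.toLp (E := ℂ) p (haar d) ℂ (mFourier β)),
    ContinuousMap.coeFn_toLp (p := p) (𝕜 := ℂ) (haar d) (mFourier α),
    ContinuousMap.coeFn_toLp (p := p) (𝕜 := ℂ) (haar d) (mFourier β)] with x h1 h2 h3 h4 h5
  rw [h1, Pi.sub_apply, h2, h3, Pi.smul_apply, Pi.smul_apply, h4, h5, smul_eq_mul, smul_eq_mul,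
    sub_mul, mul_assoc, mul_assoc]

theorem monomial_mem_analyticPolynomials {α : Fin d → ℤ} (hα : 0 ≤ α) :
    ContinuousMap.toLp (E := ℂ) p (haar d) ℂ (mFourier α) ∈ analyticPolynomials d p := by
  have h : (fun i => ((α i).toNat : ℤ)) = α := funext fun i => Int.toNat_of_nonneg (hα i)
  rw [← h]
  exact Submodule.subset_span ⟨fun i => (α i).toNat, rfl⟩

theorem isOrthogonal_of_mem_analyticPolynomials {f φ : Lp ℂ p (haar d)}
    (hf : f ∈ analyticPolynomials d p) (h : pairing f φ = 0) : IsOrthogonal f φ := by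
  rcases le_or_gt 2 p with hp | hp
  · exact .inl ⟨hp, h⟩
  · exact .inr ⟨hp, subset_closure ⟨hf, h⟩⟩

/-- The pairing of an analytic polynomial with an integrable function only depends on the
coefficients at `ℕ ^ d`. -/
theorem pairing_eq_of_mem_analyticPolynomials {g h : UnitAddTorus (Fin d) → ℂ}
    (hg : Integrable g (haar d)) (hh : Integrable h (haar d)) (c : ℂ)
    (H : ∀ α, 0 ≤ α → mFourierCoeff g α = c * mFourierCoeff h α) {f : Lp ℂ p (haar d)}
    (hf : f ∈ analyticPolynomials d p) :
    (Integrable (fun x => f x * conj (g x)) (haar d) ∧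
      Integrable (fun x => f x * conj (h x)) (haar d)) ∧
      pairing f g = conj c * pairing f h := by
  have hstar : ∀ {k : UnitAddTorus (Fin d) → ℂ}, Integrable k (haar d) →
      Integrable (fun x => conj (k x)) (haar d) := fun hk =>
    memLp_one_iff_integrable.1 (memLp_one_iff_integrable.2 hk).star
  induction hf using Submodule.span_induction with
  | mem f hf =>
    obtain ⟨α, rfl⟩ := hf
    have hc := ContinuousMap.coeFn_toLp (p := p) (𝕜 := ℂ) (haar d)
      (mFourier fun i => (α i : ℤ))
    have hi : ∀ {k : UnitAddTorus (Fin d) → ℂ}, Integrable k (haar d) →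
        Integrable (fun x => (ContinuousMap.toLp (E := ℂ) p (haar d) ℂ
          (mFourier fun i => (α i : ℤ))) x * conj (k x)) (haar d) := by
      intro k hk
      refine (integrable_bdd_mul (hstar hk) (mFourier fun i => (α i : ℤ))).congr ?_
      filter_upwards [hc] with x hx
      rw [hx]
    refine ⟨⟨hi hg, hi hh⟩, ?_⟩
    have hpair : ∀ k : UnitAddTorus (Fin d) → ℂ, pairing (ContinuousMap.toLp (E := ℂ) p (haar d) ℂ
        (mFourier fun i => (α i : ℤ))) k = conj (mFourierCoeff k fun i => (α i : ℤ)) := by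
      intro k
      rw [conj_mFourierCoeff]
      exact pairing_congr hc (ae_eq_refl k)
    rw [hpair, hpair, H _ fun i => by simp, map_mul]
  | zero =>
    have hz : ∀ k : UnitAddTorus (Fin d) → ℂ,
        (fun x => (0 : Lp ℂ p (haar d)) x * conj (k x)) =ᵐ[haar d] fun _ => 0 := by
      intro k
      filter_upwards [Lp.coeFn_zero ℂ p (haar d)] with x hx
      rw [hx, Pi.zero_apply, zero_mul]
    refine ⟨⟨(integrable_zero _ _ _).congr (hz g).symm, (integrable_zero _ _ _).congr (hz h).symm⟩,
      ?_⟩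
    rw [pairing, pairing, integral_congr_ae (hz g), integral_congr_ae (hz h)]
    simp
  | add f₁ f₂ _ _ h₁ h₂ =>
    have ha : ∀ k : UnitAddTorus (Fin d) → ℂ,
        (fun x => (f₁ + f₂ : Lp ℂ p (haar d)) x * conj (k x)) =ᵐ[haar d]
          (fun x => f₁ x * conj (k x)) + fun x => f₂ x * conj (k x) := by
      intro k
      filter_upwards [Lp.coeFn_add f₁ f₂] with x hx
      rw [hx, Pi.add_apply, Pi.add_apply, add_mul]
    refine ⟨⟨(h₁.1.1.add h₂.1.1).congr (ha g).symm, (h₁.1.2.add h₂.1.2).congr (ha h).symm⟩, ?_⟩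
    rw [pairing, pairing, integral_congr_ae (ha g), integral_congr_ae (ha h),
      integral_add' h₁.1.1 h₂.1.1, integral_add' h₁.1.2 h₂.1.2, mul_add]
    exact congrArg₂ _ h₁.2 h₂.2
  | smul a f _ hf =>
    have ha : ∀ k : UnitAddTorus (Fin d) → ℂ,
        (fun x => (a • f : Lp ℂ p (haar d)) x * conj (k x)) =ᵐ[haar d]
          fun x => a * (f x * conj (k x)) := by
      intro k
      filter_upwards [Lp.coeFn_smul a f] with x hx
      rw [hx, Pi.smul_apply, smul_eq_mul, mul_assoc]
    refine ⟨⟨(hf.1.1.const_mul a).congr (ha g).symm, (hf.1.2.const_mul a).congr (ha h).symm⟩, ?_⟩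
    rw [pairing_smul_left, pairing_smul_left, hf.2, mul_left_comm]

theorem IsHilbertPoint.pairing_powDual_eq_zero (hp : p ≠ ∞) {φ : Lp ℂ p (haar d)}
    (hφ : IsHilbertPoint φ) {f : Lp ℂ p (haar d)} (hf : f ∈ analyticPolynomials d p)
    (h : pairing f φ = 0) : pairing f (fun x => powDual p.toReal (φ x)) = 0 := by
  obtain ⟨hφH, hφ0, hmin⟩ := hφ
  have hne : p = 1 → ∀ᵐ x ∂haar d, φ x ≠ 0 := fun _ =>
    ae_ne_zero_of_analytic ((Lp.memLp φ).integrable hp1.out) hφH.2 fun h0 =>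
      hφ0 ((Lp.eq_zero_iff_ae_eq_zero).2 h0)
  have hnonneg : ∀ c : ℂ, 0 ≤ (c * pairing f fun x => powDual p.toReal (φ x)).re := by
    intro c
    rw [← pairing_smul_left]
    refine re_pairing_powDual_nonneg hp (Lp.memLp φ) (Lp.memLp _) hne
      fun t _ => ?_
    have hmem : (t : ℂ) • c • f ∈ analyticPolynomials d p :=
      Submodule.smul_mem _ _ (Submodule.smul_mem _ _ hf)
    have h1 := hmin _ (analyticPolynomials_le p hmem) (isOrthogonal_of_mem_analyticPolynomials hmem
      (by rw [pairing_smul_left, pairing_smul_left, h, mul_zero, mul_zero]))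
    rw [norm_le_norm_iff_integral hp] at h1
    refine h1.trans_eq (integral_congr_ae ?_)
    filter_upwards [Lp.coeFn_add φ ((t : ℂ) • c • f), Lp.coeFn_smul (t : ℂ) (c • f)] with x h2 h3
    rw [h2, Pi.add_apply, h3, Pi.smul_apply, smul_eq_mul]
  set P := pairing f fun x => powDual p.toReal (φ x)
  -- Rotating f by this scalar turns the sign condition into -|P|^2 ≥ 0.
  have h2 := hnonneg (-conj P)
  rw [neg_mul, mul_comm, Complex.mul_conj', Complex.neg_re] at h2
  norm_cast at h2
  rw [← norm_eq_zero]
  nlinarith [norm_nonneg P]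

theorem exists_mFourierCoeff_ne_zero {φ : Lp ℂ p (haar d)} (hφ0 : φ ≠ 0) :
    ∃ α, mFourierCoeff φ α ≠ 0 := by
  by_contra! h
  exact hφ0 ((Lp.eq_zero_iff_ae_eq_zero).2
    (ae_eq_zero_of_mFourierCoeff ((Lp.memLp φ).integrable hp1.out) h))

theorem IsHilbertPoint.exists_mFourierCoeff_powDual (hp : p ≠ ∞) {φ : Lp ℂ p (haar d)}
    (hφ : IsHilbertPoint φ) : ∃ c : ℂ, ∀ α, 0 ≤ α →
      mFourierCoeff (fun x => powDual p.toReal (φ x)) α = c * mFourierCoeff φ α := by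
  have hψ : Integrable (fun x => powDual p.toReal (φ x)) (haar d) :=
    (memLp_powDual (q := p.conjExponent) hp (Lp.memLp φ)).integrable
      (ENNReal.HolderConjugate.one_le _ p)
  have hφi := (Lp.memLp φ).integrable hp1.out
  obtain ⟨β, hβ⟩ := exists_mFourierCoeff_ne_zero hφ.2.1
  have hβ0 : 0 ≤ β := by
    by_contra h
    exact hβ (hφ.1.2 β h)
  refine ⟨mFourierCoeff (fun x => powDual p.toReal (φ x)) β / mFourierCoeff φ β, fun α hα => ?_⟩
  -- For a fixed β with φ^(β) ≠ 0, this combination of z^α and z^β is built to be orthogonal to φ.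
  have h1 := hφ.pairing_powDual_eq_zero hp
    (f := conj (mFourierCoeff φ β) • ContinuousMap.toLp (E := ℂ) p (haar d) ℂ (mFourier α)
      - conj (mFourierCoeff φ α) • ContinuousMap.toLp (E := ℂ) p (haar d) ℂ (mFourier β))
    (Submodule.sub_mem _ (Submodule.smul_mem _ _ (monomial_mem_analyticPolynomials hα))
      (Submodule.smul_mem _ _ (monomial_mem_analyticPolynomials hβ0)))
    (by rw [pairing_monomial_sub hφi]; ring)
  rw [pairing_monomial_sub hψ, ← map_mul, ← map_mul, ← map_sub, map_eq_zero] at h1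
  field_simp
  linear_combination h1

theorem conjExponent_le_two (hp : 2 ≤ p) :
    p.conjExponent ≤ 2 := by
  by_contra! h
  have h1 := ENNReal.HolderConjugate.inv_add_inv_eq_one p p.conjExponent
  have h2 := ENNReal.add_lt_add_of_le_of_lt (ENNReal.inv_ne_top.2 (by positivity))
    (ENNReal.inv_le_inv.2 hp) (ENNReal.inv_lt_inv.2 h)
  rw [h1, ENNReal.inv_two_add_inv_two] at h2
  exact lt_irrefl _ h2

theorem two_le_conjExponent (hp : p < 2) :
    2 ≤ p.conjExponent := by
  by_contra! h
  have h1 := ENNReal.HolderConjugate.inv_add_inv_eq_one p p.conjExponent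
  have h2 := ENNReal.add_lt_add (ENNReal.inv_lt_inv.2 hp) (ENNReal.inv_lt_inv.2 h)
  rw [h1, ENNReal.inv_two_add_inv_two] at h2
  exact lt_irrefl _ h2

theorem mFourierCoeff_sub_const_mul {f g : UnitAddTorus (Fin d) → ℂ} (hf : Integrable f (haar d))
    (hg : Integrable g (haar d)) (c : ℂ) (α : Fin d → ℤ) :
    mFourierCoeff (fun x => f x - c * g x) α = mFourierCoeff f α - c * mFourierCoeff g α := by
  have h : (fun x => f x - c * g x) = f + (-c) • g := by
    ext x
    simp [sub_eq_add_neg]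
  rw [h, mFourierCoeff_add hf (hg.smul (-c)), mFourierCoeff_const_smul]
  ring

theorem pairing_sub_const_mul {f g h : UnitAddTorus (Fin d) → ℂ} (c : ℂ)
    (hg : Integrable (fun x => f x * conj (g x)) (haar d))
    (hh : Integrable (fun x => f x * conj (h x)) (haar d)) :
    pairing f (fun x => g x - c * h x) = pairing f g - conj c * pairing f h := by
  rw [pairing, pairing, pairing, ← integral_const_mul, ← integral_sub hg (hh.const_mul _)]
  congr 1 with x
  rw [map_sub, map_mul]
  ring

theorem pairing_self_powDual (hp : p ≠ ∞) (φ : UnitAddTorus (Fin d) → ℂ) :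
    pairing φ (fun x => powDual p.toReal (φ x))
      = ((∫ x, ‖φ x‖ ^ p.toReal ∂haar d : ℝ) : ℂ) := by
  rw [pairing, ← integral_complex_ofReal]
  congr 1 with x
  exact mul_conj_powDual (one_le_toReal hp) _

theorem pairing_self (φ : UnitAddTorus (Fin d) → ℂ) :
    pairing φ φ = ((∫ x, ‖φ x‖ ^ 2 ∂haar d : ℝ) : ℂ) := by
  rw [pairing, ← integral_complex_ofReal]
  congr 1 with x
  rw [Complex.mul_conj']
  norm_cast

theorem integral_norm_rpow_pos (hp : p ≠ ∞) {φ : Lp ℂ p (haar d)} (hφ0 : φ ≠ 0) :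
    0 < ∫ x, ‖φ x‖ ^ p.toReal ∂haar d := by
  refine lt_of_le_of_ne (by positivity) fun h => hφ0 ?_
  have h1 := (norm_le_norm_iff_integral hp φ 0).2 (by rw [← h]; positivity)
  rwa [norm_zero, norm_le_zero_iff] at h1

theorem IsHilbertPoint.exists_isRieszProjection (hp : p ≠ ∞) {φ : Lp ℂ p (haar d)}
    (hφ : IsHilbertPoint φ) : ∃ lam : ℝ, 0 < lam ∧
      IsRieszProjection (fun x => powDual p.toReal (φ x)) (fun x => (lam : ℂ) * φ x) := by
  have hψm := memLp_powDual (q := p.conjExponent) hp (Lp.memLp φ)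
  have hq1 : Fact (1 ≤ p.conjExponent) := ⟨ENNReal.HolderConjugate.one_le _ p⟩
  have hψ : Integrable (fun x => powDual p.toReal (φ x)) (haar d) := hψm.integrable hq1.out
  have hφi := (Lp.memLp φ).integrable hp1.out
  obtain ⟨c, hc⟩ := hφ.exists_mFourierCoeff_powDual hp
  have hA := integral_norm_rpow_pos hp hφ.2.1
  have hpair := pairing_self_powDual hp (φ : UnitAddTorus (Fin d) → ℂ)
  have hc0 : c ≠ 0 := by
    rintro rfl
    rw [pairing_eq_zero_of_mFourierCoeff hp (Lp.memLp φ) hψm] at hpair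
    · exact hA.ne (Complex.ofReal_eq_zero.1 hpair.symm).symm
    · intro α
      by_cases hα : 0 ≤ α
      · rw [hc α hα, zero_mul, map_zero, mul_zero]
      · rw [hφ.1.2 α hα, zero_mul]
  have horth : ∀ α, mFourierCoeff φ α
      * conj (mFourierCoeff (fun x => powDual p.toReal (φ x) - c * φ x) α) = 0 := by
    intro α
    by_cases hα : 0 ≤ α
    · rw [mFourierCoeff_sub_const_mul hψ hφi, hc α hα, sub_self, map_zero, mul_zero]
    · rw [hφ.1.2 α hα, zero_mul]
  -- For p < 2 the conjugate exponent is at least 2, so ψ is in L^2, and φ inherits this from φ^ =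
  -- ψ^/c.
  have hφ2 : MemLp φ 2 (haar d) := by
    rcases le_or_gt 2 p with h2 | h2
    · exact (Lp.memLp φ).mono_exponent h2
    · refine memLp_two_of_norm_mFourierCoeff_le hφi (hψm.mono_exponent (two_le_conjExponent h2))
        ‖c‖⁻¹ fun α => ?_
      by_cases hα : 0 ≤ α
      · rw [hc α hα, norm_mul, inv_mul_cancel_left₀ (norm_ne_zero_iff.2 hc0)]
      · rw [hφ.1.2 α hα, norm_zero]
        positivity
  have h0 : pairing φ (fun x => powDual p.toReal (φ x) - c * φ x) = 0 := by
    rcases le_or_gt 2 p with h2 | h2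
    · exact pairing_eq_zero_of_mFourierCoeff hp (Lp.memLp φ) (hψm.sub (((Lp.memLp φ).mono_exponent
        ((conjExponent_le_two h2).trans h2)).const_mul c)) horth
    · exact pairing_eq_zero_of_mFourierCoeff (p := 2) (q := 2) ENNReal.ofNat_ne_top hφ2
        ((hψm.mono_exponent (two_le_conjExponent h2)).sub (hφ2.const_mul c)) horth
  rw [pairing_sub_const_mul c (integrable_mul_conj (Lp.memLp φ) hψm)
    (integrable_mul_conj (p := 2) (q := 2) hφ2 hφ2), hpair, pairing_self, sub_eq_zero] at h0
  set A := ∫ x, ‖φ x‖ ^ p.toReal ∂haar d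
  set B := ∫ x, ‖φ x‖ ^ 2 ∂haar d
  have hB : 0 ≤ B := integral_nonneg fun x => by positivity
  have hB0 : B ≠ 0 := by
    intro hB0
    rw [hB0, Complex.ofReal_zero, mul_zero] at h0
    exact hA.ne' (Complex.ofReal_eq_zero.1 h0)
  have hcr : c = ((A / B : ℝ) : ℂ) := by
    have : conj c = ((A / B : ℝ) : ℂ) := by
      have hB0' : (B : ℂ) ≠ 0 := Complex.ofReal_ne_zero.2 hB0
      rw [Complex.ofReal_div, h0, mul_div_cancel_right₀ _ hB0']
    rw [← Complex.conj_conj c, this, Complex.conj_ofReal]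
  refine ⟨A / B, div_pos hA (lt_of_le_of_ne hB hB0.symm), hψ, hφi.const_mul _, fun α => ?_⟩
  have hsm : (fun x => ((A / B : ℝ) : ℂ) * φ x)
      = ((A / B : ℝ) : ℂ) • (φ : UnitAddTorus (Fin d) → ℂ) := rfl
  rw [hsm, mFourierCoeff_const_smul, ← hcr]
  exact ⟨fun hα => (hc α hα).symm, fun hα => by rw [hφ.1.2 α hα, mul_zero]⟩

theorem isHilbertPoint_of_isRieszProjection (hp : p ≠ ∞) {φ : Lp ℂ p (haar d)}
    (hφ : φ ∈ hardySpace d p) (hφ0 : φ ≠ 0) {lam : ℝ}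
    (h : IsRieszProjection (fun x => powDual p.toReal (φ x)) (fun x => (lam : ℂ) * φ x)) :
    IsHilbertPoint φ := by
  have hψm := memLp_powDual (q := p.conjExponent) hp (Lp.memLp φ)
  have hq1 : Fact (1 ≤ p.conjExponent) := ⟨ENNReal.HolderConjugate.one_le _ p⟩
  have hφi := (Lp.memLp φ).integrable hp1.out
  have hr := one_le_toReal hp
  obtain ⟨hψ, -, hc⟩ := h
  have hc : ∀ α, 0 ≤ α → mFourierCoeff (fun x => powDual p.toReal (φ x)) α
      = lam * mFourierCoeff φ α := fun α hα => by
    rw [← (hc α).1 hα]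
    exact mFourierCoeff_const_smul _ _ _
  refine ⟨hφ, hφ0, fun f hf hfo => ?_⟩
  -- For p ≥ 2, the spectrum of ψ - λφ is disjoint from that of f. For p < 2, the identity holds on
  -- polynomials and passes to the closure because ψ acts continuously on L^p.
  have h0 : pairing f (fun x => powDual p.toReal (φ x)) = 0 := by
    rcases hfo with ⟨h2, hfo⟩ | ⟨h2, hfo⟩
    · have hφq := (Lp.memLp φ).mono_exponent ((conjExponent_le_two h2).trans h2)
      have h1 := pairing_eq_zero_of_mFourierCoeff hp (Lp.memLp f) (hψm.sub
        (hφq.const_mul (lam : ℂ))) fun α => by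
          by_cases hα : 0 ≤ α
          · refine mul_eq_zero_of_right _ ?_
            refine (congrArg _ (mFourierCoeff_sub_const_mul hψ hφi lam α)).trans ?_
            rw [hc α hα, sub_self, map_zero]
          · rw [hf.2 α hα, zero_mul]
      have h3 := pairing_sub_const_mul (lam : ℂ) (integrable_mul_conj (Lp.memLp f) hψm)
        (integrable_mul_conj (Lp.memLp f) hφq)
      rw [hfo, mul_zero, sub_zero] at h3
      exact h3.symm.trans h1
    · rw [← dualPairing_apply hψm]
      refine closure_minimal (t := {g | dualPairing p hψm g = 0}) ?_
        (isClosed_eq (dualPairing p hψm).continuous continuous_const) hfo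
      rintro g ⟨hg, hgφ⟩
      rw [Set.mem_ofPred_eq, dualPairing_apply,
        (pairing_eq_of_mem_analyticPolynomials hψ hφi _ hc hg).2, hgφ, mul_zero]
  have h1 : pairing (φ + f : Lp ℂ p (haar d)) (fun x => powDual p.toReal (φ x))
      = ((∫ x, ‖φ x‖ ^ p.toReal ∂haar d : ℝ) : ℂ) := by
    rw [← dualPairing_apply hψm, map_add, dualPairing_apply, dualPairing_apply, h0, add_zero,
      pairing_self_powDual hp]
  rw [norm_le_norm_iff_integral hp]
  have hi1 := (Lp.memLp φ).integrable_norm_rpow (zero_lt_one.trans_le hp1.out).ne' hp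
  have hi2 := (Lp.memLp (φ + f)).integrable_norm_rpow (zero_lt_one.trans_le hp1.out).ne' hp
  have h2 : ‖pairing (φ + f : Lp ℂ p (haar d)) (fun x => powDual p.toReal (φ x))‖
      ≤ ∫ x, (1 / p.toReal * ‖(φ + f : Lp ℂ p (haar d)) x‖ ^ p.toReal
        + (1 - 1 / p.toReal) * ‖φ x‖ ^ p.toReal) ∂haar d := by
    refine norm_integral_le_of_norm_le ((hi2.const_mul _).add (hi1.const_mul _))
      (.of_forall fun x => ?_)
    rw [norm_mul, RCLike.norm_conj]
    exact norm_mul_norm_powDual_le hr _ _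
  rw [h1, integral_add (hi2.const_mul _) (hi1.const_mul _), integral_const_mul, integral_const_mul,
    Complex.norm_real, Real.norm_of_nonneg (by positivity)] at h2
  have h3 : 0 < 1 / p.toReal := by positivity
  refine le_of_mul_le_mul_left ?_ h3
  linarith

end
-- Part (b): Hilbert points and the dual norm.
theorem pairing_sub_left {d : ℕ} {p : ℝ≥0∞} {f g : Lp ℂ p (haar d)} {h : UnitAddTorus (Fin d) → ℂ}
    (hf : MemLp f 2 (haar d)) (hg : MemLp g 2 (haar d)) (hh : MemLp h 2 (haar d)) :
    pairing (f - g : Lp ℂ p (haar d)) h = pairing f h - pairing g h := by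
  rw [pairing, pairing, pairing, ← integral_sub (integrable_mul_conj (p := 2) (q := 2) hf hh)
    (integrable_mul_conj (p := 2) (q := 2) hg hh)]
  refine integral_congr_ae ?_
  filter_upwards [Lp.coeFn_sub f g] with x hx
  rw [hx, Pi.sub_apply, sub_mul]

theorem exists_extension_of_norm_le {E : Type*} [NormedAddCommGroup E] [NormedSpace ℂ E]
    (V : Submodule ℂ E) (l : V →ₗ[ℂ] ℂ) {C : ℝ} (hC : 0 ≤ C) (hl : ∀ g, ‖l g‖ ≤ C * ‖g‖) :
    ∃ L : E →L[ℂ] ℂ, (∀ x : V, L x = l x) ∧ ‖L‖ ≤ C := by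
  obtain ⟨L, hL, hLn⟩ := exists_extension_norm_eq V (l.mkContinuous _ hl)
  exact ⟨L, hL, hLn.trans_le (l.mkContinuous_norm_le hC hl)⟩

section

variable {d : ℕ} {p : ℝ≥0∞} [hp1 : Fact (1 ≤ p)]

/-- The inclusion of `L^2` into `L^p` for `p ≤ 2`. -/
def inclusionOfLeTwo (d : ℕ) (p : ℝ≥0∞) [Fact (1 ≤ p)] (hp : p ≤ 2) :
    Lp ℂ 2 (haar d) →L[ℂ] Lp ℂ p (haar d) :=
  LinearMap.mkContinuous
    { toFun := fun f => ((Lp.memLp f).mono_exponent hp).toLp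
      map_add' := fun f g => by
        rw [← MemLp.toLp_add]
        exact MemLp.toLp_congr _ _ (Lp.coeFn_add f g)
      map_smul' := fun c f => by
        rw [RingHom.id_apply, ← MemLp.toLp_const_smul]
        exact MemLp.toLp_congr _ _ (Lp.coeFn_smul c f) } 1 fun f => by
    rw [one_mul, LinearMap.coe_mk, AddHom.coe_mk, Lp.norm_toLp, Lp.norm_def]
    exact ENNReal.toReal_mono (Lp.eLpNorm_ne_top f)
      (eLpNorm_le_eLpNorm_of_exponent_le hp (Lp.memLp f).1)

theorem coeFn_inclusionOfLeTwo (hp : p ≤ 2) (f : Lp ℂ 2 (haar d)) :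
    inclusionOfLeTwo d p hp f =ᵐ[haar d] f :=
  MemLp.coeFn_toLp ((Lp.memLp f).mono_exponent hp)

theorem inclusionOfLeTwo_mem_analyticPolynomials (hp : p ≤ 2) {f : Lp ℂ 2 (haar d)}
    (hf : f ∈ analyticPolynomials d 2) : inclusionOfLeTwo d p hp f ∈ analyticPolynomials d p := by
  induction hf using Submodule.span_induction with
  | mem f hf =>
    obtain ⟨α, rfl⟩ := hf
    refine Submodule.subset_span ⟨α, Lp.ext ?_⟩
    exact (ContinuousMap.coeFn_toLp (haar d) _).trans
      ((coeFn_inclusionOfLeTwo hp _).trans (ContinuousMap.coeFn_toLp (haar d) _)).symm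
  | zero => rw [map_zero]; exact Submodule.zero_mem _
  | add f g _ _ hf hg => rw [map_add]; exact Submodule.add_mem _ hf hg
  | smul c f _ hf => rw [map_smul]; exact Submodule.smul_mem _ c hf

theorem mem_closure_analyticPolynomials {f : Lp ℂ 2 (haar d)} (hf : f ∈ hardySpace d 2) :
    f ∈ closure (analyticPolynomials d 2 : Set (Lp ℂ 2 (haar d))) := by
  have hs : HasSum (fun α => mFourierCoeff f α • ContinuousMap.toLp (E := ℂ) 2 (haar d) ℂ
      (mFourier α)) f := hasSum_mFourier_series_L2 f
  refine mem_closure_of_tendsto hs (.of_forall fun s => Submodule.sum_mem _ fun α _ => ?_)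
  by_cases hα : 0 ≤ α
  · exact Submodule.smul_mem _ _ (monomial_mem_analyticPolynomials hα)
  · rw [hf.2 α hα, zero_smul]
    exact Submodule.zero_mem _

/-- The continuous projection x ↦ x - (L x / L e) e maps D into D ∩ ker L and fixes g. -/
theorem mem_closure_inter_ker {E : Type*} [NormedAddCommGroup E] [NormedSpace ℂ E]
    {D : Submodule ℂ E} {L : E →L[ℂ] ℂ} {e g : E} (he : e ∈ D) (hLe : L e ≠ 0)
    (hg : g ∈ closure (D : Set E)) (hLg : L g = 0) : g ∈ closure {x | x ∈ D ∧ L x = 0} := by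
  have hc : Continuous fun x => x - (L x / L e) • e := by fun_prop
  have := map_mem_closure (t := {x | x ∈ D ∧ L x = 0}) hc hg fun x hx =>
    ⟨Submodule.sub_mem _ hx (Submodule.smul_mem _ _ he), by simp [hLe]⟩
  simpa [hLg] using this

/-- On `H^p ∩ H^2` the relation `⟨g, φ⟩ = 0` has its usual meaning. -/
theorem isOrthogonal_of_memLp_two {φ g : Lp ℂ p (haar d)} (hφ : φ ∈ hardySpace d p) (hφ0 : φ ≠ 0)
    (hφ2 : MemLp φ 2 (haar d)) (hg : g ∈ hardySpace d p) (hg2 : MemLp g 2 (haar d))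
    (h : pairing g φ = 0) : IsOrthogonal g φ := by
  rcases le_or_gt 2 p with hp | hp
  · exact .inl ⟨hp, h⟩
  refine .inr ⟨hp, ?_⟩
  obtain ⟨β, hβ⟩ := exists_mFourierCoeff_ne_zero hφ0
  have hβ0 : 0 ≤ β := by
    by_contra h
    exact hβ (hφ.2 β h)
  have hGH : hg2.toLp ∈ hardySpace d 2 :=
    ⟨Lp.memLp _, fun α hα => by rw [mFourierCoeff_congr hg2.coeFn_toLp, hg.2 α hα]⟩
  have hLe : dualPairing 2 hφ2
      (ContinuousMap.toLp (E := ℂ) 2 (haar d) ℂ (mFourier β)) ≠ 0 := by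
    have := pairing_monomial_sub (p := 2) ((Lp.memLp φ).integrable hp1.out) 1 0 β β
    rw [one_smul, zero_smul, sub_zero, one_mul, zero_mul, sub_zero] at this
    rw [dualPairing_apply, this]
    exact (map_ne_zero _).2 hβ
  -- Approximate in L^2, correcting by a monomial not orthogonal to φ; the inclusion into L^p then
  -- carries the closure over.
  have h1 := mem_closure_inter_ker (monomial_mem_analyticPolynomials hβ0) hLe
    (mem_closure_analyticPolynomials hGH)
    (by rw [dualPairing_apply, pairing_congr hg2.coeFn_toLp (ae_eq_refl _), h])
  have h2 := map_mem_closure (inclusionOfLeTwo d p hp.le).continuous h1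
    (t := {g : Lp ℂ p (haar d) | g ∈ analyticPolynomials d p ∧ pairing g φ = 0}) fun f hf => by
      refine ⟨inclusionOfLeTwo_mem_analyticPolynomials hp.le hf.1, ?_⟩
      rw [pairing_congr (coeFn_inclusionOfLeTwo hp.le f) (ae_eq_refl _), ← dualPairing_apply hφ2,
        hf.2]
  have h3 : inclusionOfLeTwo d p hp.le hg2.toLp = g :=
    Lp.ext ((coeFn_inclusionOfLeTwo hp.le _).trans hg2.coeFn_toLp)
  rwa [h3] at h2

theorem memLp_two_of_mem_analyticPolynomials {f : Lp ℂ p (haar d)}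
    (hf : f ∈ analyticPolynomials d p) : MemLp f 2 (haar d) := by
  induction hf using Submodule.span_induction with
  | mem f hf =>
    obtain ⟨α, rfl⟩ := hf
    refine MemLp.ae_eq (ContinuousMap.coeFn_toLp (haar d) _).symm ?_
    exact (MemLp.of_bound (mFourier _).continuous.aestronglyMeasurable _
      (.of_forall (mFourier _).norm_coe_le_norm))
  | zero => exact MemLp.zero.ae_eq (Lp.coeFn_zero ℂ p (haar d)).symm
  | add f g _ _ hf hg => exact (hf.add hg).ae_eq (Lp.coeFn_add f g).symm
  | smul c f _ hf => exact (hf.const_smul c).ae_eq (Lp.coeFn_smul c f).symm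

theorem IsFunctionalOf.apply_eq_zero {φ : Lp ℂ p (haar d)} {L : hardySpace d p →L[ℂ] ℂ}
    (hL : IsFunctionalOf φ L) (f : hardySpace d p) (hf : IsOrthogonal (f : Lp ℂ p (haar d)) φ) :
    L f = 0 := by
  rcases hf with ⟨hp, hf⟩ | ⟨-, hf⟩
  · rw [hL f ⟨(Lp.memLp _).mono_exponent hp, f.2.2⟩, hf]
  · let S : Set (hardySpace d p) := {g | (g : Lp ℂ p (haar d)) ∈ analyticPolynomials d p ∧
      pairing (g : Lp ℂ p (haar d)) φ = 0}
    have hS : f ∈ closure S := by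
      rw [closure_subtype]
      refine closure_mono (fun g hg => ?_) hf
      exact ⟨⟨g, analyticPolynomials_le p hg.1⟩, hg, rfl⟩
    refine closure_minimal (t := {g | L g = 0}) (fun g hg => ?_)
      (isClosed_eq L.continuous continuous_const) hS
    exact (hL g ⟨memLp_two_of_mem_analyticPolynomials hg.1, g.2.2⟩).trans hg.2

/-- With c = ⟨g, φ⟩ ≠ 0, the function (B/c)g - φ is orthogonal to φ, so minimality gives ‖φ‖ ≤
‖(B/c)g‖. -/
theorem IsHilbertPoint.norm_mul_norm_pairing_le {φ : Lp ℂ p (haar d)} (hφ : IsHilbertPoint φ)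
    (hφ2 : MemLp φ 2 (haar d)) {g : Lp ℂ p (haar d)} (hg : g ∈ hardySpace d p)
    (hg2 : MemLp g 2 (haar d)) :
    ‖φ‖ * ‖pairing g φ‖ ≤ (∫ x, ‖φ x‖ ^ 2 ∂haar d) * ‖g‖ := by
  set B := ∫ x, ‖φ x‖ ^ 2 ∂haar d with hB
  have hB0 : 0 ≤ B := integral_nonneg fun x => by positivity
  by_cases hc : pairing g φ = 0
  · rw [hc, norm_zero, mul_zero]
    positivity
  set c := pairing g φ
  have hs2 : MemLp (((B : ℂ) / c) • g : Lp ℂ p (haar d)) 2 (haar d) :=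
    (hg2.const_smul _).ae_eq (Lp.coeFn_smul _ g).symm
  have hmem : ((B : ℂ) / c) • g - φ ∈ hardySpace d p :=
    Submodule.sub_mem _ (Submodule.smul_mem _ _ hg) hφ.1
  have h1 := hφ.2.2 _ hmem (isOrthogonal_of_memLp_two hφ.1 hφ.2.1 hφ2 hmem
    ((hs2.sub hφ2).ae_eq (Lp.coeFn_sub _ _).symm) (by
      rw [pairing_sub_left hs2 hφ2 hφ2, pairing_smul_left, pairing_self, div_mul_cancel₀ _ hc, hB,
        sub_self]))
  rw [add_sub_cancel, norm_smul, norm_div, Complex.norm_real, Real.norm_of_nonneg hB0,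
    div_mul_eq_mul_div, le_div_iff₀ (norm_pos_iff.2 hc)] at h1
  exact h1

/-- Hahn-Banach from H^p ∩ H^2, with bound B/‖φ‖; density of the intersection is not needed. -/
theorem IsHilbertPoint.exists_isFunctionalOf {φ : Lp ℂ p (haar d)} (hφ : IsHilbertPoint φ)
    (hφ2 : MemLp φ 2 (haar d)) : ∃ L : hardySpace d p →L[ℂ] ℂ, IsFunctionalOf φ L ∧
      ‖φ‖ * ‖L‖ ≤ ∫ x, ‖φ x‖ ^ 2 ∂haar d := by
  have hpos : 0 < ‖φ‖ := norm_pos_iff.2 hφ.2.1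
  set B := ∫ x, ‖φ x‖ ^ 2 ∂haar d with hB
  have hB0 : 0 ≤ B := integral_nonneg fun x => by positivity
  let V : Submodule ℂ (hardySpace d p) :=
    { carrier := {g | MemLp (g : Lp ℂ p (haar d)) 2 (haar d)}
      zero_mem' := MemLp.zero.ae_eq (Lp.coeFn_zero ℂ p (haar d)).symm
      add_mem' := fun {f g} hf hg => (MemLp.add hf hg).ae_eq (Lp.coeFn_add _ _).symm
      smul_mem' := fun c f hf => (MemLp.const_smul hf c).ae_eq (Lp.coeFn_smul c _).symm }
  let l : V →ₗ[ℂ] ℂ :=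
    { toFun := fun g => pairing ((g : hardySpace d p) : Lp ℂ p (haar d)) φ
      map_add' := fun f g => by
        rw [pairing, pairing, pairing,
          ← integral_add (integrable_mul_conj (p := 2) (q := 2) f.2 hφ2)
            (integrable_mul_conj (p := 2) (q := 2) g.2 hφ2)]
        refine integral_congr_ae ?_
        filter_upwards [Lp.coeFn_add ((f : hardySpace d p) : Lp ℂ p (haar d))
          ((g : hardySpace d p) : Lp ℂ p (haar d))] with x hx
        rw [Submodule.coe_add, Submodule.coe_add, hx, Pi.add_apply, add_mul]
      map_smul' := fun c f => pairing_smul_left c _ _ }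
  have hl : ∀ g, ‖l g‖ ≤ B / ‖φ‖ * ‖g‖ := by
    intro g
    rw [div_mul_eq_mul_div, le_div_iff₀ hpos, mul_comm]
    exact hφ.norm_mul_norm_pairing_le hφ2 (g : hardySpace d p).2 g.2
  obtain ⟨L, hL, hLn⟩ := exists_extension_of_norm_le V l (by positivity) hl
  refine ⟨L, fun g hg => hL ⟨g, hg.1⟩, ?_⟩
  rwa [mul_comm, ← le_div_iff₀ hpos]

theorem eLpNorm_two_sq {φ : UnitAddTorus (Fin d) → ℂ} (hφ2 : MemLp φ 2 (haar d)) :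
    eLpNorm φ 2 (haar d) ^ 2 = ENNReal.ofReal (∫ x, ‖φ x‖ ^ 2 ∂haar d) := by
  have hB0 : 0 ≤ ∫ x, ‖φ x‖ ^ 2 ∂haar d := integral_nonneg fun x => by positivity
  rw [hφ2.eLpNorm_eq_integral_rpow_norm two_ne_zero ENNReal.ofNat_ne_top,
    ← ENNReal.ofReal_pow (by positivity)]
  simp only [ENNReal.toReal_ofNat, Real.rpow_two]
  rw [← Real.rpow_natCast, ← Real.rpow_mul hB0]
  norm_num

theorem IsFunctionalOf.le_enorm_mul {φ : Lp ℂ p (haar d)} {L : hardySpace d p →L[ℂ] ℂ}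
    (hL : IsFunctionalOf φ L) (hφ : MemHardy d 2 φ) (hφp : φ ∈ hardySpace d p) {f : Lp ℂ p (haar d)}
    (hf : f ∈ hardySpace d p) (hfo : IsOrthogonal f φ) :
    ENNReal.ofReal (∫ x, ‖φ x‖ ^ 2 ∂haar d) ≤ ‖L‖ₑ * ‖φ + f‖ₑ := by
  have h1 : L (⟨φ, hφp⟩ + ⟨f, hf⟩) = ((∫ x, ‖φ x‖ ^ 2 ∂haar d : ℝ) : ℂ) := by
    rw [map_add, hL.apply_eq_zero ⟨f, hf⟩ hfo, add_zero, hL ⟨φ, hφp⟩ hφ]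
    exact pairing_self φ
  have h2 := L.le_opENorm (⟨φ, hφp⟩ + ⟨f, hf⟩)
  rw [h1] at h2
  refine le_trans (le_of_eq ?_) h2
  rw [← ofReal_norm, Complex.norm_real,
    Real.norm_of_nonneg (integral_nonneg fun x => by positivity)]

theorem isHilbertPoint_iff_hardyDualNorm {φ : Lp ℂ p (haar d)} (hφp : φ ∈ hardySpace d p)
    (hφ0 : φ ≠ 0) (hφ : MemHardy d 2 φ) :
    IsHilbertPoint φ ↔ eLpNorm φ p (haar d) * hardyDualNorm p φ = eLpNorm φ 2 (haar d) ^ 2 := by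
  have hN0 : ‖φ‖ₑ ≠ 0 := enorm_ne_zero.2 hφ0
  have hNt : ‖φ‖ₑ ≠ ∞ := enorm_ne_top
  rw [eLpNorm_two_sq hφ.1, ← Lp.enorm_def, ← ENNReal.eq_div_iff hN0 hNt]
  set B := ∫ x, ‖φ x‖ ^ 2 ∂haar d with hB
  -- This bound serves both directions: f = 0 gives the lower bound for the dual norm, and general f
  -- gives minimality. It also holds when no L exists, the infimum then being ∞.
  have hle : ∀ {f : Lp ℂ p (haar d)}, f ∈ hardySpace d p → IsOrthogonal f φ →
      ENNReal.ofReal B / ‖φ + f‖ₑ ≤ hardyDualNorm p φ := fun hf hfo =>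
    le_iInf₂ fun L hL => ENNReal.div_le_of_le_mul (hL.le_enorm_mul hφ hφp hf hfo)
  constructor
  · intro h
    refine le_antisymm ?_ ?_
    · obtain ⟨L, hL, hLn⟩ := h.exists_isFunctionalOf hφ.1
      refine (iInf₂_le L hL).trans ?_
      rw [ENNReal.le_div_iff_mul_le (.inl hN0) (.inl hNt), mul_comm, ← ofReal_norm,
        ← ofReal_norm, ← ENNReal.ofReal_mul (norm_nonneg _)]
      exact ENNReal.ofReal_le_ofReal hLn
    · have hz : IsOrthogonal (0 : Lp ℂ p (haar d)) φ := by
        refine isOrthogonal_of_mem_analyticPolynomials (Submodule.zero_mem _) ?_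
        have := pairing_smul_left 0 (0 : Lp ℂ p (haar d)) φ
        rwa [smul_zero, zero_mul] at this
      simpa using hle (Submodule.zero_mem _) hz
  · intro h
    refine ⟨hφp, hφ0, fun f hf hfo => ?_⟩
    have hB0 : ENNReal.ofReal B ≠ 0 := by
      rw [← eLpNorm_two_sq hφ.1]
      refine pow_ne_zero _ fun h0 => hφ0 ?_
      rw [eLpNorm_eq_zero_iff hφ.1.1 two_ne_zero] at h0
      exact (Lp.eq_zero_iff_ae_eq_zero).2 h0
    have h1 := hle hf hfo
    rw [h, div_eq_mul_inv, div_eq_mul_inv,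
      ENNReal.mul_le_mul_iff_right hB0 ENNReal.ofReal_ne_top, ENNReal.inv_le_inv] at h1
    rwa [enorm_le_iff_norm_le] at h1

end

end HardyTorus

end

theorem mainTheorem7 (d : ℕ) (hd : 1 ≤ d) (p : ℝ≥0∞) [Fact (1 ≤ p)]
    (φ : Lp ℂ p (HardyTorus.haar d)) (hφ : φ ∈ HardyTorus.hardySpace d p) (hφ0 : φ ≠ 0) :
    (p ≠ ∞ →
      (HardyTorus.IsHilbertPoint φ ↔
        ∃ lam : ℝ, 0 < lam ∧
          HardyTorus.IsRieszProjection
            (fun x => ((‖φ x‖ ^ (p.toReal - 2) : ℝ) : ℂ) * φ x)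
            (fun x => (lam : ℂ) * φ x))) ∧
    (HardyTorus.MemHardy d 2 φ →
      (HardyTorus.IsHilbertPoint φ ↔
        eLpNorm φ p (HardyTorus.haar d) * HardyTorus.hardyDualNorm p φ
          = eLpNorm φ 2 (HardyTorus.haar d) ^ 2)) := by
  refine ⟨fun hp => ⟨fun h => h.exists_isRieszProjection hp, fun ⟨_, _, h⟩ =>
    HardyTorus.isHilbertPoint_of_isRieszProjection hp hφ hφ0 h⟩, fun h2 =>
    HardyTorus.isHilbertPoint_iff_hardyDualNorm hφ hφ0 h2⟩
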